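/- Let $\mathbb{H}$ be the quaternions with units $i,j,k$, let $\mathbb{C}_j=\mathbb{R}\oplus j\mathbb{R}$, and for $q\in\mathbb{H}$ write $\tilde q=\overline{(-jqj)}$, so that $\tilde q=a+bi-cj+dk$ for $q=a+bi+cj+dk$. For $f\in L^2(\mathbb{R},\mathbb{H})$ let $\hat f(\omega)=\int_{-\infty}^{+\infty}f(t)e^{-j\omega t}\,dt$ be its quaternion Fourier transform of axis $j$, extended to $L^2(\mathbb{R},\mathbb{H})$ as the $L^2$-limit of the transforms of the truncations $f\mathbf 1_{[-R,R]}$ as $R\to\infty$. Let $H^2(\mathbb{R},\mathbb{H})$ be the set of $f\in L^2(\mathbb{R},\mathbb{H})$ with $\hat f(\omega)=0$ for almost all $\omega<0$, and let $H^2(\mathbb{R},\mathbb{C}_j)$ be its subset of $\mathbb{C}_j$-valued functions. **Theorem (inversion formula and energy conservation for the quaternion continuous wavelet transform).** Let $f\in H^2(\mathbb{R},\mathbb{H})$ and let $\psi\in H^2(\mathbb{R},\mathbb{C}_j)$ satisfy $\|\psi\|_{L^2}=1$ and the admissibility condition $$C_\psi=\int_0^{+\infty}\frac{|\hat\psi(\omega)|^2}{\omega}\,d\omega<\infty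 .$$ For $u\in\mathbb{R}$ and $s>0$ let $\psi_{u,s}(t)=\frac1{\sqrt s}\psi\left(\frac{t-u}{s}\right)$ and $$Wf(u,s)=\int_{-\infty}^{+\infty}f(t)\,\overline{\psi_{u,s}(t)}\,dt .$$ Then $C_\psi>0$ and the following hold. 1. (Inversion formula) $$f(t)=C_\psi^{-1}\int_0^{+\infty}\int_{-\infty}^{+\infty}Wf(u,s)\,\psi_{u,s}(t)\,du\,\frac{ds}{s^2}$$ in $L^2(\mathbb{R},\mathbb{H})$, in the following sense: for all $0<\varepsilon\le A<\infty$ and every $t\in\mathbb{R}$ the integral $b_{\varepsilon,A}(t)=\int_\varepsilon^A\int_{-\infty}^{+\infty}Wf(u,s)\,\psi_{u,s}(t)\,du\,\frac{ds}{s^2}$ converges absolutely, $b_{\varepsilon,A}\in L^2(\mathbb{R},\mathbb{H})$, and $\|C_\psi^{-1}b_{\varepsilon,A}-f\|_{L^2}\to0$ as $\varepsilon\to0^+$ and $A\to+\infty$ (independently). 2. (Energy) $$\frac1{C_\psi}\int_0^{+\infty}\int_{-\infty}^{+\infty}|Wf(u,s)|^2\,du\,\frac{ds}{s^2}=\int_{-\infty}^{+\infty}|f(t)|^2\,dt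 .$$ 3. (Polarization) $$\int_{-\infty}^{+\infty}f(t)\,\widetilde{f(t)}\,dt=\frac1{C_\psi}\int_0^{+\infty}\int_{-\infty}^{+\infty}Wf(u,s)\,\widetilde{Wf(u,s)}\,du\,\frac{ds}{s^2}.$$ The integrals over $\mathbb{R}\times(0,\infty)$ in 2 and 3 converge absolutely. -/

import Mathlib

open MeasureTheory Set Filter Topology Quaternion
open scoped ENNReal FourierTransform

noncomputable section

namespace QCWT

/-- The quaternion unit `j`. -/
def quatJ : ℍ := ⟨0, 0, 1, 0⟩

/-- `exp(j θ) = cos θ + j sin θ`. -/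
def expJ (θ : ℝ) : ℍ := ⟨Real.cos θ, 0, Real.sin θ, 0⟩

theorem expJ_re (θ : ℝ) : (expJ θ).re = Real.cos θ := rfl

theorem expJ_imI (θ : ℝ) : (expJ θ).imI = 0 := rfl

theorem expJ_imJ (θ : ℝ) : (expJ θ).imJ = Real.sin θ := rfl

theorem expJ_imK (θ : ℝ) : (expJ θ).imK = 0 := rfl

/-- The conjugate of the involution `q ↦ -j q j`. -/
def involJ (q : ℍ) : ℍ := star (-(quatJ * q * quatJ))

theorem quatJ_re : quatJ.re = 0 := rfl

theorem quatJ_imI : quatJ.imI = 0 := rfl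

theorem quatJ_imJ : quatJ.imJ = 1 := rfl

theorem quatJ_imK : quatJ.imK = 0 := rfl

/-- In coordinates, `a + b i + c j + d k` is sent to `a + b i - c j + d k`. -/
theorem involJ_eq (q : ℍ) : involJ q = ⟨q.re, q.imI, -q.imJ, q.imK⟩ := by
  unfold involJ
  ext <;> simp [quatJ_re, quatJ_imI, quatJ_imJ, quatJ_imK]

/-- The quaternion Fourier integral of axis `j`, `∫ f(t) exp(-j ω t) dt`, with the exponential
on the right (meaningful for integrable `f`). -/
def qftIntegral (f : ℝ → ℍ) (ω : ℝ) : ℍ := ∫ t : ℝ, f t * expJ (-(ω * t))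

/-- `g` is the quaternion Fourier transform (of axis `j`) of the square integrable function `f`:
it is square integrable and it is the limit in `L²` of the Fourier integrals of the truncations of
`f` to `[-R, R]` (which are integrable and square integrable), as `R → ∞`. -/
def IsQFT (f g : ℝ → ℍ) : Prop :=
  MemLp g 2 volume ∧
    Tendsto (fun R : ℝ => eLpNorm (qftIntegral ((Icc (-R) R).indicator f) - g) 2 volume)
      atTop (𝓝 0)

open Classical in
/-- The quaternion Fourier transform (of axis `j`) on `L²(ℝ, ℍ)`. It exists for every square
integrable function and is unique up to equality almost everywhere, see `isQFT_qft` and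
`IsQFT.ae_eq`. -/
def qft (f : ℝ → ℍ) : ℝ → ℍ := if h : ∃ g, IsQFT f g then h.choose else 0

/-- Membership in the Hardy space `H²(ℝ, ℍ)`: square integrable, with a Fourier transform that
vanishes at (almost) all negative frequencies. -/
def MemHardy (f : ℝ → ℍ) : Prop :=
  MemLp f 2 volume ∧ ∀ᵐ ω : ℝ, ω < 0 → qft f ω = 0

/-- Polarization wavelets: functions `ψ ∈ H²(ℝ, ℂ_j)`, where `ℂ_j = ℝ ⊕ j ℝ`, with `‖ψ‖ = 1`. -/
structure IsPolarizationWavelet (ψ : ℝ → ℍ) : Prop where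
  memHardy : MemHardy ψ
  values : ∀ᵐ t : ℝ, (ψ t).imI = 0 ∧ (ψ t).imK = 0
  norm_eq_one : ∫ t : ℝ, ‖ψ t‖ ^ 2 = 1

/-- The atom `ψ_{u,s}(t) = s^{-1/2} ψ((t - u) / s)`, for `s > 0`. -/
def atom (ψ : ℝ → ℍ) (u s t : ℝ) : ℍ := (√s)⁻¹ • ψ ((t - u) / s)

/-- The quaternion continuous wavelet transform
`Wf(u, s) = ⟨f, ψ_{u,s}⟩ = ∫ f(t) conj(ψ_{u,s}(t)) dt`. -/
def cwt (ψ f : ℝ → ℍ) (u s : ℝ) : ℍ := ∫ t : ℝ, f t * star (atom ψ u s t)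

/-- The constant `C_ψ = ∫₀^∞ |ψ̂(ω)|² / ω dω`. -/
def admConst (ψ : ℝ → ℍ) : ℝ := ∫ ω in Ioi (0 : ℝ), ‖qft ψ ω‖ ^ 2 / ω

/-- The admissibility condition `C_ψ < ∞`. -/
def IsAdmissible (ψ : ℝ → ℍ) : Prop :=
  IntegrableOn (fun ω : ℝ => ‖qft ψ ω‖ ^ 2 / ω) (Ioi 0) volume

/-- The synthesis integral over the scales between `ε` and `A`:
`∫_ε^A ∫_ℝ Wf(u, s) ψ_{u,s}(t) du ds / s²`. -/
def synth (ψ f : ℝ → ℍ) (ε A t : ℝ) : ℍ :=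
  ∫ s in Icc ε A, (s ^ 2)⁻¹ • ∫ u : ℝ, cwt ψ f u s * atom ψ u s t

/-! Existence and uniqueness of the quaternion Fourier transform on `L²`. -/

theorem fourier_toLp_ae {h : ℝ → ℂ} (h1 : Integrable h) (h2 : MemLp h 2 volume) :
    (𝓕 (h2.toLp h) : Lp ℂ 2 (volume : Measure ℝ)) =ᵐ[volume] 𝓕 h := by
  have hcont : Continuous (𝓕 h) :=
    VectorFourier.fourierIntegral_continuous Real.continuous_fourierChar
      (L := innerₗ ℝ) (by exact continuous_inner) h1
  refine ae_eq_of_integral_contDiff_smul_eq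
    ((Lp.memLp _).locallyIntegrable (by norm_num)) hcont.locallyIntegrable ?_
  intro g g_smooth g_cpt
  have hg₁ : HasCompactSupport (Complex.ofRealCLM ∘ g) := g_cpt.comp_left rfl
  have hg₂ : ContDiff ℝ (⊤ : ℕ∞) (Complex.ofRealCLM ∘ g) := by fun_prop
  have e1 := congrArg (fun T => T (hg₁.toSchwartzMap hg₂))
    (Lp.fourier_toTemperedDistribution_eq (h2.toLp h))
  simp only [Lp.toTemperedDistribution_apply, TemperedDistribution.fourier_apply] at e1
  have e2 := VectorFourier.integral_fourierIntegral_smul_eq_flip (L := innerₗ ℝ)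
    Real.continuous_fourierChar (by exact continuous_inner) (μ := volume) (ν := volume)
    (hg₁.toSchwartzMap hg₂).integrable h1
  have e3 : ∫ x, (𝓕 (hg₁.toSchwartzMap hg₂)) x • (h2.toLp h : ℝ → ℂ) x
      = ∫ x, (𝓕 (hg₁.toSchwartzMap hg₂)) x • h x := by
    apply integral_congr_ae
    filter_upwards [h2.coeFn_toLp] with x hx
    rw [hx]
  rw [e3] at e1
  simp only [SchwartzMap.fourier_coe] at e1
  have e4 := e1.symm.trans e2
  simpa using! e4

/-- The quaternion `z + i w` for `z, w ∈ ℂ ≅ ℂ_j`. -/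
def ofPair (z w : ℂ) : ℍ := ⟨z.re, w.re, z.im, w.im⟩

/-- The components `z`, `w` of `q = z + i w`. -/
def fstJ (q : ℍ) : ℂ := ⟨q.re, q.imJ⟩

/-- The components `z`, `w` of `q = z + i w`. -/
def sndJ (q : ℍ) : ℂ := ⟨q.imI, q.imK⟩

theorem norm_ofPair_le (z w : ℂ) : ‖ofPair z w‖ ≤ ‖z‖ + ‖w‖ := by
  have h : ‖ofPair z w‖ ^ 2 = ‖z‖ ^ 2 + ‖w‖ ^ 2 := by
    rw [sq, ← Quaternion.normSq_eq_norm_mul_self, Quaternion.normSq_def', Complex.sq_norm,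
      Complex.sq_norm, Complex.normSq_apply, Complex.normSq_apply]
    simp only [ofPair]; ring
  nlinarith [norm_nonneg z, norm_nonneg w, norm_nonneg (ofPair z w)]

theorem norm_fstJ_le (q : ℍ) : ‖fstJ q‖ ≤ ‖q‖ := by
  refine le_of_sq_le_sq ?_ (norm_nonneg _)
  rw [sq ‖q‖, ← Quaternion.normSq_eq_norm_mul_self, Quaternion.normSq_def', Complex.sq_norm,
      Complex.normSq_apply]
  simp only [fstJ]; nlinarith [sq_nonneg q.imI, sq_nonneg q.imK]

theorem norm_sndJ_le (q : ℍ) : ‖sndJ q‖ ≤ ‖q‖ := by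
  refine le_of_sq_le_sq ?_ (norm_nonneg _)
  rw [sq ‖q‖, ← Quaternion.normSq_eq_norm_mul_self, Quaternion.normSq_def', Complex.sq_norm,
      Complex.normSq_apply]
  simp only [sndJ]; nlinarith [sq_nonneg q.re, sq_nonneg q.imJ]

theorem continuous_fstJ : Continuous fstJ := by
  have : fstJ = fun q : ℍ => (q.re : ℂ) + (q.imJ : ℂ) * Complex.I := by
    funext q; apply Complex.ext <;> simp [fstJ]
  rw [this]
  have := Quaternion.continuous_re
  have := Quaternion.continuous_imJ
  fun_prop

theorem continuous_sndJ : Continuous sndJ := by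
  have : sndJ = fun q : ℍ => (q.imI : ℂ) + (q.imK : ℂ) * Complex.I := by
    funext q; apply Complex.ext <;> simp [sndJ]
  rw [this]
  have := Quaternion.continuous_imI
  have := Quaternion.continuous_imK
  fun_prop

theorem continuous_ofPair : Continuous fun p : ℂ × ℂ => ofPair p.1 p.2 := by
  have : (fun p : ℂ × ℂ => ofPair p.1 p.2) = fun p : ℂ × ℂ =>
      (Quaternion.linearIsometryEquivTuple.symm
        (WithLp.toLp 2 ![p.1.re, p.2.re, p.1.im, p.2.im]) : ℍ) := by
    funext p
    rw [LinearIsometryEquiv.eq_symm_apply]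
    rfl
  rw [this]
  refine Quaternion.linearIsometryEquivTuple.symm.continuous.comp ?_
  refine (PiLp.continuous_toLp 2 _).comp ?_
  refine continuous_pi fun i => ?_
  fin_cases i <;> simp <;> fun_prop

theorem ofPair_sub (z w z' w' : ℂ) : ofPair z w - ofPair z' w' = ofPair (z - z') (w - w') := rfl

/-- `fstJ` as a continuous real linear map. -/
def fstL : ℍ →L[ℝ] ℂ :=
  ⟨{ toFun := fstJ
     map_add' := fun p q => by apply Complex.ext <;> simp [fstJ]
     map_smul' := fun c q => by apply Complex.ext <;> simp [fstJ] }, continuous_fstJ⟩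

/-- `sndJ` as a continuous real linear map. -/
def sndL : ℍ →L[ℝ] ℂ :=
  ⟨{ toFun := sndJ
     map_add' := fun p q => by apply Complex.ext <;> simp [sndJ]
     map_smul' := fun c q => by apply Complex.ext <;> simp [sndJ] }, continuous_sndJ⟩

theorem integrable_mul_expJ {f : ℝ → ℍ} (hf : Integrable f) (ω : ℝ) :
    Integrable (fun t : ℝ => f t * expJ (-(ω * t))) := by
  have hc : Continuous fun t : ℝ => expJ (-(ω * t)) := by
    have e : (fun t : ℝ => expJ (-(ω * t))) = fun t : ℝ =>
        ofPair ((Real.cos (-(ω * t)) : ℂ) + (Real.sin (-(ω * t)) : ℂ) * Complex.I) 0 := by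
      funext t
      simp only [expJ, ofPair]
      congr 1 <;> simp [-Complex.ofReal_cos, -Complex.ofReal_sin]
    rw [e]
    exact continuous_ofPair.comp (f := fun t : ℝ =>
      (((Real.cos (-(ω * t)) : ℂ) + (Real.sin (-(ω * t)) : ℂ) * Complex.I), (0 : ℂ)))
      (by fun_prop)
  refine (hf.norm.mul_const 2).mono' (hf.1.mul hc.aestronglyMeasurable) ?_
  refine Eventually.of_forall fun t => ?_
  rw [norm_mul]
  refine mul_le_mul_of_nonneg_left ?_ (norm_nonneg _)
  have h : ‖expJ (-(ω * t))‖ * ‖expJ (-(ω * t))‖ = 1 := by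
    rw [← Quaternion.normSq_eq_norm_mul_self, Quaternion.normSq_def']
    simp [expJ]
  nlinarith [norm_nonneg (expJ (-(ω * t)))]

theorem qftIntegral_eq {f : ℝ → ℍ} (hf : Integrable f) (ω : ℝ) :
    qftIntegral f ω = ofPair (𝓕 (fun t => fstJ (f t)) (ω / (2 * Real.pi)))
      (𝓕 (fun t => sndJ (f t)) (ω / (2 * Real.pi))) := by
  have hI := integrable_mul_expJ hf ω
  have hc : ∀ t : ℝ, Complex.exp (((-2 * Real.pi * t * (ω / (2 * Real.pi)) : ℝ) : ℂ) * Complex.I)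
      = ⟨Real.cos (-(ω * t)), Real.sin (-(ω * t))⟩ := by
    intro t
    have : (-2 * Real.pi * t * (ω / (2 * Real.pi)) : ℝ) = -(ω * t) := by
      field_simp
    rw [this]
    apply Complex.ext
    · rw [Complex.exp_ofReal_mul_I_re]
    · rw [Complex.exp_ofReal_mul_I_im]
  have e1 : fstJ (qftIntegral f ω) = 𝓕 (fun t => fstJ (f t)) (ω / (2 * Real.pi)) := by
    rw [Real.fourier_real_eq_integral_exp_smul]
    change fstL (∫ t : ℝ, f t * expJ (-(ω * t))) = _
    rw [← fstL.integral_comp_comm hI]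
    refine integral_congr_ae (Eventually.of_forall fun t => ?_)
    simp only [hc]
    change fstJ _ = _
    apply Complex.ext <;> simp [fstJ, expJ_re, expJ_imI, expJ_imJ, expJ_imK] <;> ring
  have e2 : sndJ (qftIntegral f ω) = 𝓕 (fun t => sndJ (f t)) (ω / (2 * Real.pi)) := by
    rw [Real.fourier_real_eq_integral_exp_smul]
    change sndL (∫ t : ℝ, f t * expJ (-(ω * t))) = _
    rw [← sndL.integral_comp_comm hI]
    refine integral_congr_ae (Eventually.of_forall fun t => ?_)
    simp only [hc]
    change sndJ _ = _
    apply Complex.ext <;> simp [sndJ, expJ_re, expJ_imI, expJ_imJ, expJ_imK] <;> ring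
  rw [← e1, ← e2]
  ext <;> simp [ofPair, fstJ, sndJ]

theorem integrable_trunc {F : Type*} [NormedAddCommGroup F] {f : ℝ → F} (hf : MemLp f 2 volume) (R : ℝ) :
    Integrable ((Icc (-R) R).indicator f) := by
  rw [integrable_indicator_iff measurableSet_Icc]
  exact (hf.locallyIntegrable (by norm_num)).integrableOn_isCompact isCompact_Icc

theorem tendsto_trunc {F : Type*} [NormedAddCommGroup F] {f : ℝ → F} (hf : MemLp f 2 volume) :
    Tendsto (fun R : ℝ => eLpNorm ((Icc (-R) R).indicator f - f) 2 volume) atTop (𝓝 0) := by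
  have key : Tendsto (fun R : ℝ => ∫⁻ t, ‖((Icc (-R) R).indicator f - f) t‖ₑ ^ (2 : ℝ))
      atTop (𝓝 (∫⁻ _ : ℝ, 0)) := by
    refine tendsto_lintegral_filter_of_dominated_convergence' (fun t => ‖f t‖ₑ ^ (2 : ℝ)) ?_ ?_ ?_ ?_
    · refine Eventually.of_forall fun R => ?_
      exact ((hf.1.indicator measurableSet_Icc).sub hf.1).enorm.pow_const _
    · refine Eventually.of_forall fun R => Eventually.of_forall fun t => ?_
      by_cases ht : t ∈ Icc (-R) R <;> simp [ht]
    · have := hf.2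
      rw [eLpNorm_lt_top_iff_lintegral_rpow_enorm_lt_top (by norm_num) (by norm_num)] at this
      simpa using this.ne
    · refine Eventually.of_forall fun t => ?_
      refine tendsto_const_nhds.congr' ?_
      filter_upwards [eventually_ge_atTop |t|] with R hR
      have : t ∈ Icc (-R) R := abs_le.1 hR
      simp [this]
  have h2 := (ENNReal.continuous_rpow_const (y := (1 / 2 : ℝ))).continuousAt.tendsto.comp key
  simp only [lintegral_zero] at h2
  rw [ENNReal.zero_rpow_of_pos (by norm_num)] at h2
  refine h2.congr fun R => ?_
  rw [eLpNorm_eq_lintegral_rpow_enorm_toReal (by norm_num) (by norm_num)]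
  simp

theorem eLpNorm_rescale {F : Type*} [NormedAddCommGroup F] {h : ℝ → F}
    (hh : AEStronglyMeasurable h volume) {c : ℝ} (hc : 0 < c) :
    eLpNorm (fun ω => h (ω / c)) 2 volume = ENNReal.ofReal c ^ (1 / 2 : ℝ) * eLpNorm h 2 volume := by
  have hmap : Measure.map (fun ω : ℝ => ω / c) volume = ENNReal.ofReal c • (volume : Measure ℝ) := by
    have := Real.map_volume_mul_right (a := c⁻¹) (inv_ne_zero hc.ne')
    simpa [div_eq_mul_inv, abs_of_pos hc] using this
  have hm : AEMeasurable (fun ω : ℝ => ω / c) volume := by fun_prop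
  have := eLpNorm_map_measure (p := 2) (f := fun ω : ℝ => ω / c) (g := h) (μ := volume)
    (by rw [hmap]; exact hh.smul_measure _) hm
  rw [hmap, eLpNorm_smul_measure_of_ne_top (by norm_num)] at this
  simpa [Function.comp_def] using this.symm

theorem aesm_rescale {F : Type*} [NormedAddCommGroup F] {h : ℝ → F}
    (hh : AEStronglyMeasurable h volume) {c : ℝ} (hc : 0 < c) :
    AEStronglyMeasurable (fun ω => h (ω / c)) volume := by
  have hmap : Measure.map (fun ω : ℝ => ω / c) volume = ENNReal.ofReal c • (volume : Measure ℝ) := by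
    have := Real.map_volume_mul_right (a := c⁻¹) (inv_ne_zero hc.ne')
    simpa [div_eq_mul_inv, abs_of_pos hc] using this
  have hm : AEMeasurable (fun ω : ℝ => ω / c) volume := by fun_prop
  exact AEStronglyMeasurable.comp_aemeasurable (g := h) (by rw [hmap]; exact hh.smul_measure _) hm

theorem aesm_fourier {h : ℝ → ℂ} (h1 : Integrable h) : AEStronglyMeasurable (𝓕 h) volume :=
  (VectorFourier.fourierIntegral_continuous Real.continuous_fourierChar
      (L := innerₗ ℝ) (by exact continuous_inner) h1).aestronglyMeasurable

theorem eLpNorm_fourier_trunc_sub {h : ℝ → ℂ} (hh : MemLp h 2 volume) (R : ℝ) :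
    eLpNorm (𝓕 ((Icc (-R) R).indicator h) - ((𝓕 (hh.toLp h) : Lp ℂ 2 (volume : Measure ℝ)) : ℝ → ℂ)) 2 volume
      = eLpNorm ((Icc (-R) R).indicator h - h) 2 volume := by
  have h2 := hh.indicator (s := Icc (-R) R) measurableSet_Icc
  have e := fourier_toLp_ae (integrable_trunc hh R) h2
  have e1 : 𝓕 ((Icc (-R) R).indicator h) - ((𝓕 (hh.toLp h) : Lp ℂ 2 (volume : Measure ℝ)) : ℝ → ℂ)
      =ᵐ[volume]
      ((𝓕 (h2.toLp _ - hh.toLp h) : Lp ℂ 2 (volume : Measure ℝ)) : ℝ → ℂ) := by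
    have hs : (𝓕 (h2.toLp _ - hh.toLp h) : Lp ℂ 2 (volume : Measure ℝ)) =
        𝓕 (h2.toLp _) - 𝓕 (hh.toLp h) := (Lp.fourierTransformₗᵢ ℝ ℂ).map_sub _ _
    rw [hs]
    filter_upwards [e, Lp.coeFn_sub (𝓕 (h2.toLp _)) (𝓕 (hh.toLp h))] with x hx hx'
    rw [hx', Pi.sub_apply, Pi.sub_apply, hx]
  have e2 : (h2.toLp _ - hh.toLp h : Lp ℂ 2 (volume : Measure ℝ)) =ᵐ[volume]
      (Icc (-R) R).indicator h - h := by
    rw [← MemLp.toLp_sub]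
    exact MemLp.coeFn_toLp _
  rw [eLpNorm_congr_ae e1, ← eLpNorm_congr_ae e2, ← Lp.enorm_def, ← Lp.enorm_def,
    ← ofReal_norm, ← ofReal_norm, Lp.norm_fourier_eq]

theorem memLp_fstJ {f : ℝ → ℍ} (hf : MemLp f 2 volume) : MemLp (fun t => fstJ (f t)) 2 volume :=
  hf.mono (continuous_fstJ.comp_aestronglyMeasurable hf.1)
    (Eventually.of_forall fun _ => norm_fstJ_le _)

theorem memLp_sndJ {f : ℝ → ℍ} (hf : MemLp f 2 volume) : MemLp (fun t => sndJ (f t)) 2 volume :=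
  hf.mono (continuous_sndJ.comp_aestronglyMeasurable hf.1)
    (Eventually.of_forall fun _ => norm_sndJ_le _)

/-- The quaternion Fourier transform of a square integrable function through the complex Fourier
transforms of its two `ℂ_j`-components. -/
def qftPair (f : ℝ → ℍ) (hf : MemLp f 2 volume) (ω : ℝ) : ℍ :=
  ofPair
    ((𝓕 ((memLp_fstJ hf).toLp _) : Lp ℂ 2 (volume : Measure ℝ)) (ω / (2 * Real.pi)))
    ((𝓕 ((memLp_sndJ hf).toLp _) : Lp ℂ 2 (volume : Measure ℝ)) (ω / (2 * Real.pi)))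

theorem isQFT_qftPair {f : ℝ → ℍ} (hf : MemLp f 2 volume) : IsQFT f (qftPair f hf) := by
  have hpi : (0 : ℝ) < 2 * Real.pi := by positivity
  set G1 : Lp ℂ 2 (volume : Measure ℝ) := 𝓕 ((memLp_fstJ hf).toLp _) with hG1
  set G2 : Lp ℂ 2 (volume : Measure ℝ) := 𝓕 ((memLp_sndJ hf).toLp _) with hG2
  have m1 := aesm_rescale (Lp.memLp G1).1 hpi
  have m2 := aesm_rescale (Lp.memLp G2).1 hpi
  constructor
  · have L1 : MemLp (fun ω => G1 (ω / (2 * Real.pi))) 2 volume := ⟨m1, by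
      rw [eLpNorm_rescale (Lp.memLp G1).1 hpi]
      exact ENNReal.mul_lt_top
        (ENNReal.rpow_lt_top_of_nonneg (by norm_num) ENNReal.ofReal_ne_top) (Lp.memLp G1).2⟩
    have L2 : MemLp (fun ω => G2 (ω / (2 * Real.pi))) 2 volume := ⟨m2, by
      rw [eLpNorm_rescale (Lp.memLp G2).1 hpi]
      exact ENNReal.mul_lt_top
        (ENNReal.rpow_lt_top_of_nonneg (by norm_num) ENNReal.ofReal_ne_top) (Lp.memLp G2).2⟩
    refine (L1.norm.add L2.norm).mono (continuous_ofPair.comp_aestronglyMeasurable (m1.prodMk m2)) ?_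
    refine Eventually.of_forall fun ω => ?_
    exact (norm_ofPair_le _ _).trans (Real.le_norm_self _)
  · set C : ℝ≥0∞ := ENNReal.ofReal (2 * Real.pi) ^ (1 / 2 : ℝ) with hC
    have hCtop : C ≠ ∞ := 
      ENNReal.rpow_ne_top_of_nonneg (by norm_num) ENNReal.ofReal_ne_top
    have t1 := tendsto_trunc (memLp_fstJ hf)
    have t2 := tendsto_trunc (memLp_sndJ hf)
    have hub : Tendsto (fun R : ℝ =>
        C * eLpNorm ((Icc (-R) R).indicator (fun t => fstJ (f t)) - fun t => fstJ (f t)) 2 volume +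
        C * eLpNorm ((Icc (-R) R).indicator (fun t => sndJ (f t)) - fun t => sndJ (f t)) 2 volume)
        atTop (𝓝 0) := by
      simpa using (ENNReal.Tendsto.const_mul t1 (Or.inr hCtop)).add
        (ENNReal.Tendsto.const_mul t2 (Or.inr hCtop))
    refine tendsto_of_tendsto_of_tendsto_of_le_of_le tendsto_const_nhds hub
      (fun _ => bot_le) fun R => ?_
    have i1 := integrable_trunc (memLp_fstJ hf) R
    have i2 := integrable_trunc (memLp_sndJ hf) R
    set H1 := 𝓕 ((Icc (-R) R).indicator (fun t => fstJ (f t))) - (G1 : ℝ → ℂ) with hH1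
    set H2 := 𝓕 ((Icc (-R) R).indicator (fun t => sndJ (f t))) - (G2 : ℝ → ℂ) with hH2
    have a1 : AEStronglyMeasurable H1 volume := (aesm_fourier i1).sub (Lp.memLp G1).1
    have a2 : AEStronglyMeasurable H2 volume := (aesm_fourier i2).sub (Lp.memLp G2).1
    have c1 : (fun t => fstJ ((Icc (-R) R).indicator f t)) =
        (Icc (-R) R).indicator (fun t => fstJ (f t)) := by
      ext1 t; by_cases ht : t ∈ Icc (-R) R <;> simp [ht, fstJ]; rfl
    have c2 : (fun t => sndJ ((Icc (-R) R).indicator f t)) =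
        (Icc (-R) R).indicator (fun t => sndJ (f t)) := by
      ext1 t; by_cases ht : t ∈ Icc (-R) R <;> simp [ht, sndJ]; rfl
    have b1 := eLpNorm_fourier_trunc_sub (memLp_fstJ hf) R
    have b2 := eLpNorm_fourier_trunc_sub (memLp_sndJ hf) R
    simp only
    rw [← b1, ← b2, ← eLpNorm_rescale a1 hpi, ← eLpNorm_rescale a2 hpi,
      ← eLpNorm_norm (fun ω => H1 (ω / (2 * Real.pi))),
      ← eLpNorm_norm (fun ω => H2 (ω / (2 * Real.pi)))]
    refine le_trans ?_ (eLpNorm_add_le (aesm_rescale a1 hpi).norm (aesm_rescale a2 hpi).norm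
      (by norm_num))
    refine eLpNorm_mono fun ω => ?_
    refine le_trans ?_ (Real.le_norm_self _)
    have : (qftIntegral ((Icc (-R) R).indicator f) - qftPair f hf) ω =
        ofPair (H1 (ω / (2 * Real.pi))) (H2 (ω / (2 * Real.pi))) := by
      rw [Pi.sub_apply, qftIntegral_eq (integrable_trunc hf R), c1, c2, qftPair, ofPair_sub]
      rfl
    rw [this]
    exact norm_ofPair_le _ _

theorem IsQFT.ae_eq {f g g' : ℝ → ℍ} (hf : MemLp f 2 volume) (h : IsQFT f g) (h' : IsQFT f g') :
    g =ᵐ[volume] g' := by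
  have hm : ∀ R : ℝ, AEStronglyMeasurable (qftIntegral ((Icc (-R) R).indicator f)) volume := by
    intro R
    have hpi : (0 : ℝ) < 2 * Real.pi := by positivity
    have hi := integrable_trunc hf R
    have e : qftIntegral ((Icc (-R) R).indicator f) = _ := funext fun ω => qftIntegral_eq hi ω
    rw [e]
    exact continuous_ofPair.comp_aestronglyMeasurable
      ((aesm_rescale (aesm_fourier (fstL.integrable_comp hi)) hpi).prodMk
        (aesm_rescale (aesm_fourier (sndL.integrable_comp hi)) hpi))
  have h0 : Tendsto (fun R : ℝ =>
      eLpNorm (qftIntegral ((Icc (-R) R).indicator f) - g) 2 volume +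
      eLpNorm (qftIntegral ((Icc (-R) R).indicator f) - g') 2 volume) atTop (𝓝 0) := by
    simpa using h.2.add h'.2
  have hle : eLpNorm (g' - g) 2 volume ≤ 0 := by
    refine ge_of_tendsto h0 (Eventually.of_forall fun R => ?_)
    have : g' - g = (qftIntegral ((Icc (-R) R).indicator f) - g) -
        (qftIntegral ((Icc (-R) R).indicator f) - g') := by abel
    rw [this]
    exact eLpNorm_sub_le ((hm R).sub h.1.1) ((hm R).sub h'.1.1) (by norm_num)
  have := (eLpNorm_eq_zero_iff (h'.1.1.sub h.1.1) (by norm_num)).1 (le_antisymm hle bot_le)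
  filter_upwards [this] with x hx
  simpa [sub_eq_zero, eq_comm] using hx

theorem isQFT_qft {f : ℝ → ℍ} (hf : MemLp f 2 volume) : IsQFT f (qft f) := by
  have h : ∃ g, IsQFT f g := ⟨_, isQFT_qftPair hf⟩
  rw [qft, dif_pos h]
  exact h.choose_spec

theorem qft_ae_eq {f : ℝ → ℍ} (hf : MemLp f 2 volume) : qft f =ᵐ[volume] qftPair f hf :=
  (isQFT_qft hf).ae_eq hf (isQFT_qftPair hf)

end QCWT

end

noncomputable section

/-! Every quaternion is `z + i w` with `z`, `w` in `ℂ_j ≅ ℂ`, and right multiplication by an element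
of `ℂ_j` acts on `z` and `w` separately. The Fourier kernel and, almost everywhere, the wavelet take
values in `ℂ_j` and stand on the right. So the quaternion transforms are pairs of complex ones, and
the Hardy condition on `f` passes to both components.

In the complex case, Plancherel turns `u ↦ Wz(u, s)` into the inverse Fourier transform of `√s ẑ(ξ)
conj(Φ(s ξ))` with `Φ = φ̂` (`ccwt_eq_fourier`). A second Plancherel in `u`, followed by Fubini,
leaves the Calderón integral `∫₀^∞ |Φ(s ξ)|² ds / s`. By invariance of `ds / s` it equals the
constant `C` for `ξ > 0`, and it is `0` for `ξ ≤ 0` (`integral_dilate`). Hence `s⁻¹ Wz` lies in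
`L²(ds du)`, and `⟨Wz, Ww⟩ = C ⟨z, w⟩` as soon as `z` is Hardy, with no spectral condition on `w`
(`integral_analysis_mul_star_of_hardy`). Energy is the case `w = z` in each component. Polarization
follows because the components of `f f̃` are `z z̄ - w w̄` and `2 w z̄`.

For inversion, the analysis operator `T` is bounded on all of `L²`, and Parseval says `T* T z = C z`
for Hardy `z` (`adjoint_analysisL_of_hardy`). The synthesis integral over a band of scales is `T*`
applied to `T z` cut off to that band (`adjoint_analysisL_indicator`). The cut-offs converge to `T
z` in `L²` by dominated convergence, and `T*` is continuous. -/

namespace QCWT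

/-! ### Fourier transforms of square integrable functions and of wavelet atoms. -/

/-- The complex exponential `exp(-2 π i u ξ)`. -/
def phase (u ξ : ℝ) : ℂ := Complex.exp (((-2 * Real.pi * u * ξ : ℝ) : ℂ) * Complex.I)

theorem norm_phase (u ξ : ℝ) : ‖phase u ξ‖ = 1 := Complex.norm_exp_ofReal_mul_I _

theorem continuous_phase : Continuous fun p : ℝ × ℝ => phase p.1 p.2 := by
  unfold phase
  fun_prop

/-- The Fourier transform of a square integrable function. -/
def ft (h : ℝ → ℂ) (hh : MemLp h 2 volume) : Lp ℂ 2 (volume : Measure ℝ) := 𝓕 (hh.toLp h)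

/-- The duality defining the Fourier transform of a tempered distribution, which agrees with the
`L²` transform. -/
theorem integral_fourier_mul {h : ℝ → ℂ} (hh : MemLp h 2 volume) {q : ℝ → ℂ}
    (hq : HasCompactSupport q) (hq' : ContDiff ℝ (⊤ : ℕ∞) q) :
    ∫ x, 𝓕 q x * h x = ∫ x, q x * ft h hh x := by
  have e1 := congrArg (fun T => T (hq.toSchwartzMap hq'))
    (Lp.fourier_toTemperedDistribution_eq (hh.toLp h))
  simp only [Lp.toTemperedDistribution_apply, TemperedDistribution.fourier_apply,
    SchwartzMap.fourier_coe] at e1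
  refine Eq.trans ?_ e1
  apply integral_congr_ae
  filter_upwards [hh.coeFn_toLp] with x hx
  rw [hx]
  rfl

theorem ft_ae_eq {h g : ℝ → ℂ} (hh : MemLp h 2 volume) (hg : LocallyIntegrable g volume)
    (H : ∀ q : ℝ → ℂ, HasCompactSupport q → ContDiff ℝ (⊤ : ℕ∞) q →
      ∫ x, 𝓕 q x * h x = ∫ x, q x * g x) : ft h hh =ᵐ[volume] g := by
  refine ae_eq_of_integral_contDiff_smul_eq
    ((Lp.memLp _).locallyIntegrable (by norm_num)) hg ?_
  intro q q_smooth q_cpt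
  have hq₁ : HasCompactSupport (Complex.ofRealCLM ∘ q) := q_cpt.comp_left rfl
  have hq₂ : ContDiff ℝ (⊤ : ℕ∞) (Complex.ofRealCLM ∘ q) := by fun_prop
  have := (integral_fourier_mul hh hq₁ hq₂).symm.trans (H _ hq₁ hq₂)
  simpa using this

theorem memLp_comp_mul {F : Type*} [NormedAddCommGroup F] {h : ℝ → F} (hh : MemLp h 2 volume)
    {s : ℝ} (hs : 0 < s) : MemLp (fun x => h (s * x)) 2 volume := by
  have e : (fun x => h (s * x)) = fun x => h (x / s⁻¹) := by
    funext x; congr 1; field_simp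
  rw [e]
  refine ⟨aesm_rescale hh.1 (inv_pos.2 hs), ?_⟩
  rw [eLpNorm_rescale hh.1 (inv_pos.2 hs)]
  exact ENNReal.mul_lt_top
    (ENNReal.rpow_lt_top_of_nonneg (by norm_num) ENNReal.ofReal_ne_top) hh.2

/-- The complex atom `s^{-1/2} φ((t - u) / s)`. -/
def catom (φ : ℝ → ℂ) (u s t : ℝ) : ℂ := ((√s)⁻¹ : ℝ) * φ ((t - u) / s)

theorem memLp_catom {φ : ℝ → ℂ} (hφ : MemLp φ 2 volume) (u : ℝ) {s : ℝ} (hs : 0 < s) :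
    MemLp (catom φ u s) 2 volume := by
  have h1 : MemLp (fun t => φ (s⁻¹ * t)) 2 volume := memLp_comp_mul hφ (inv_pos.2 hs)
  have h2 := h1.comp_measurePreserving (measurePreserving_sub_right volume u)
  refine MemLp.ae_eq (Eventually.of_forall fun t => ?_) (h2.const_mul (((√s)⁻¹ : ℝ) : ℂ))
  simp [catom, div_eq_inv_mul]

/-- As `φ` is only square integrable, no Fourier integral is available for a change of variables.
The translation and dilation are moved by duality onto a test function, where the computation is
classical. -/
theorem ft_catom {φ : ℝ → ℂ} (hφ : MemLp φ 2 volume) (u : ℝ) {s : ℝ} (hs : 0 < s) :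
    ft (catom φ u s) (memLp_catom hφ u hs) =ᵐ[volume]
      fun ξ => (√s : ℂ) * phase u ξ * ft φ hφ (s * ξ) := by
  have hs' : (s : ℂ) ≠ 0 := by exact_mod_cast hs.ne'
  have hΦ : MemLp (fun ξ => ft φ hφ (s * ξ)) 2 volume := memLp_comp_mul (Lp.memLp _) hs
  refine ft_ae_eq _ ?_ fun q hq hq' => ?_
  · have hc : Continuous (phase u) := continuous_phase.comp (Continuous.prodMk_right u)
    refine MemLp.locallyIntegrable (p := 2) ?_ (by norm_num)
    have h3 := hΦ.const_mul (√s : ℂ)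
    refine h3.mono ((aestronglyMeasurable_const.mul hc.aestronglyMeasurable).mul hΦ.1) ?_
    refine Eventually.of_forall fun ξ => ?_
    simp [norm_phase]
  -- Chosen so that `𝓕 q (u + s x) = 𝓕 q₁ x`: the substitution `t = u + s x` in the pairing then
  -- puts `φ` itself against `𝓕 q₁`.
  · set q₁ : ℝ → ℂ := fun ξ => ((s⁻¹ : ℝ) : ℂ) * phase (u / s) ξ * q (s⁻¹ * ξ) with hq₁
    have hcs : HasCompactSupport q₁ := by
      refine HasCompactSupport.mul_left ?_
      exact hq.comp_homeomorph (Homeomorph.mulLeft₀ s⁻¹ (inv_ne_zero hs.ne'))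
    have hcd : ContDiff ℝ (⊤ : ℕ∞) q₁ := by
      have : ContDiff ℝ (⊤ : ℕ∞) fun ξ : ℝ => phase (u / s) ξ := by
        unfold phase
        have : ContDiff ℝ (⊤ : ℕ∞) fun ξ : ℝ => ((-2 * Real.pi * (u / s) * ξ : ℝ) : ℂ) :=
          Complex.ofRealCLM.contDiff.comp
            (contDiff_const.mul contDiff_id : ContDiff ℝ (⊤ : ℕ∞) fun ξ : ℝ =>
              (-2 * Real.pi * (u / s)) * ξ)
        exact (this.mul contDiff_const).cexp
      exact (contDiff_const.mul this).mul (hq'.comp (by fun_prop))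
    have hF : ∀ x : ℝ, 𝓕 q (u + s * x) = 𝓕 q₁ x := by
      intro x
      rw [Real.fourier_real_eq_integral_exp_smul, Real.fourier_real_eq_integral_exp_smul]
      have := Measure.integral_comp_mul_left
        (fun v : ℝ => Complex.exp (((-2 * Real.pi * v * (u + s * x) : ℝ) : ℂ) * Complex.I) • q v) s⁻¹
      rw [inv_inv, abs_of_pos hs] at this
      have h2 : ∫ v : ℝ, Complex.exp (((-2 * Real.pi * v * (u + s * x) : ℝ) : ℂ) * Complex.I) • q v
          = (s⁻¹ : ℝ) • ∫ x_1 : ℝ, Complex.exp (((-2 * Real.pi * (s⁻¹ * x_1) * (u + s * x) : ℝ) : ℂ)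
            * Complex.I) • q (s⁻¹ * x_1) := by
        rw [this, smul_smul, inv_mul_cancel₀ hs.ne', one_smul]
      rw [h2, ← integral_smul]
      congr 1
      funext v
      have : (((-2 * Real.pi * (s⁻¹ * v) * (u + s * x) : ℝ) : ℂ) * Complex.I)
          = ((-2 * Real.pi * v * x : ℝ) : ℂ) * Complex.I +
            ((-2 * Real.pi * (u / s) * v : ℝ) : ℂ) * Complex.I := by
        push_cast; field_simp; ring
      rw [this, Complex.exp_add, hq₁]
      simp only [phase, smul_eq_mul, Complex.real_smul]
      ring
    have e1 : ∫ t, 𝓕 q t * catom φ u s t = (√s : ℂ) * ∫ x, 𝓕 q₁ x * φ x := by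
      have a1 := integral_add_left_eq_self (μ := volume) (fun t => 𝓕 q t * catom φ u s t) u
      have a2 := Measure.integral_comp_mul_left (fun t => 𝓕 q (u + t) * catom φ u s (u + t)) s
      rw [a1, abs_of_pos (inv_pos.2 hs)] at a2
      have a3 : ∫ t, 𝓕 q t * catom φ u s t =
          (s : ℝ) • ∫ x, 𝓕 q (u + s * x) * catom φ u s (u + s * x) := by
        rw [a2, smul_smul, mul_inv_cancel₀ hs.ne', one_smul]
      rw [a3, ← integral_smul, ← integral_const_mul]
      congr 1
      funext x
      have h1 : (u + s * x - u) / s = x := by field_simp; ring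
      have h2 : ((s : ℝ) : ℂ) = (√s : ℂ) * (√s : ℂ) := by
        rw [← Complex.ofReal_mul, Real.mul_self_sqrt hs.le]
      have h3 : (√s : ℂ) ≠ 0 := by
        exact_mod_cast (Real.sqrt_pos.2 hs).ne'
      rw [hF, catom, h1, Complex.real_smul, h2]
      push_cast
      field_simp
    rw [e1, integral_fourier_mul hφ hcs hcd, ← integral_const_mul]
    have a2 := Measure.integral_comp_mul_left (fun ξ => (√s : ℂ) * (q₁ ξ * ft φ hφ ξ)) s
    rw [abs_of_pos (inv_pos.2 hs)] at a2
    have a3 : ∫ ξ, (√s : ℂ) * (q₁ ξ * ft φ hφ ξ) =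
        (s : ℝ) • ∫ x, (√s : ℂ) * (q₁ (s * x) * ft φ hφ (s * x)) := by
      rw [a2, smul_smul, mul_inv_cancel₀ hs.ne', one_smul]
    rw [a3, ← integral_smul]
    congr 1
    funext x
    have h1 : s⁻¹ * (s * x) = x := by field_simp
    have h2 : phase (u / s) (s * x) = phase u x := by
      unfold phase; congr 3; field_simp
    rw [hq₁]
    simp only [h1, h2, Complex.real_smul]
    push_cast
    field_simp

theorem integral_mul_star_eq_ft {h g : ℝ → ℂ} (hh : MemLp h 2 volume) (hg : MemLp g 2 volume) :
    ∫ x, h x * star (g x) = ∫ ξ, ft h hh ξ * star (ft g hg ξ) := by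
  have := Lp.inner_fourier_eq (hg.toLp g) (hh.toLp h)
  rw [L2.inner_def, L2.inner_def] at this
  refine Eq.trans ?_ (this.symm.trans ?_)
  · apply integral_congr_ae
    filter_upwards [hh.coeFn_toLp, hg.coeFn_toLp] with x hx hx'
    rw [hx, hx', RCLike.inner_apply]
    rfl
  · simp only [RCLike.inner_apply]
    rfl

/-! ### The complex wavelet transform at a fixed scale. -/

/-- The complex wavelet transform `∫ z(t) conj(φ_{u,s}(t)) dt`. -/
def ccwt (φ z : ℝ → ℂ) (u s : ℝ) : ℂ := ∫ t : ℝ, z t * star (catom φ u s t)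

/-- `φ` is an admissible wavelet whose Fourier transform is represented by the function `Φ`
supported on the positive frequencies. -/
structure AnalyticWavelet (φ Φ : ℝ → ℂ) : Prop where
  stronglyMeasurable : StronglyMeasurable φ
  memLp : MemLp φ 2 volume
  measurable : StronglyMeasurable Φ
  ft_ae : ft φ memLp =ᵐ[volume] Φ
  zero : ∀ ξ ≤ 0, Φ ξ = 0
  integrable : IntegrableOn (fun x => ‖Φ x‖ ^ 2 / x) (Ioi 0) volume

/-- The admissibility constant of a Fourier transform `Φ`. -/
def cadm (Φ : ℝ → ℂ) : ℝ := ∫ x in Ioi (0 : ℝ), ‖Φ x‖ ^ 2 / x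

/-- Lebesgue measure on the half plane of pairs (scale, translation). -/
def halfPlane : Measure (ℝ × ℝ) := (volume.restrict (Ioi (0 : ℝ))).prod volume

namespace AnalyticWavelet

variable {φ Φ z w : ℝ → ℂ}

theorem memLp_hat (h : AnalyticWavelet φ Φ) : MemLp Φ 2 volume :=
  (Lp.memLp (ft φ h.memLp)).ae_eq h.ft_ae

theorem ft_catom_ae (h : AnalyticWavelet φ Φ) (u : ℝ) {s : ℝ} (hs : 0 < s) :
    ft (catom φ u s) (memLp_catom h.memLp u hs) =ᵐ[volume]
      fun ξ => (√s : ℂ) * phase u ξ * Φ (s * ξ) := by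
  have hq : Measure.QuasiMeasurePreserving (fun ξ : ℝ => s * ξ) volume volume := by
    refine ⟨by fun_prop, ?_⟩
    rw [Real.map_volume_mul_left hs.ne']
    exact Measure.smul_absolutelyContinuous
  filter_upwards [ft_catom h.memLp u hs, hq.ae h.ft_ae] with ξ h1 h2
  rw [h1, h2]

/-- The Fourier transform of `u ↦ ccwt φ z u s`. -/
def slice (Φ : ℝ → ℂ) (hz : MemLp z 2 volume) (s ξ : ℝ) : ℂ :=
  (√s : ℂ) * (ft z hz ξ * star (Φ (s * ξ)))

theorem integrable_slice (h : AnalyticWavelet φ Φ) (hz : MemLp z 2 volume) {s : ℝ} (hs : 0 < s) :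
    Integrable (slice Φ hz s) := by
  refine Integrable.const_mul ?_ _
  exact (Lp.memLp (ft z hz)).integrable_mul (memLp_comp_mul h.memLp_hat hs).star

theorem ccwt_eq_integral (h : AnalyticWavelet φ Φ) (hz : MemLp z 2 volume) (u : ℝ) {s : ℝ}
    (hs : 0 < s) : ccwt φ z u s = ∫ ξ, star (phase u ξ) * slice Φ hz s ξ := by
  rw [ccwt, integral_mul_star_eq_ft hz (memLp_catom h.memLp u hs)]
  apply integral_congr_ae
  filter_upwards [h.ft_catom_ae u hs] with ξ h1
  rw [h1, slice]
  simp only [star_mul', RCLike.star_def, Complex.conj_ofReal]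
  ring

theorem star_phase (u ξ : ℝ) : star (phase u ξ) = phase (-u) ξ := by
  rw [phase, phase, RCLike.star_def, ← Complex.exp_conj, map_mul, Complex.conj_ofReal,
    Complex.conj_I]
  congr 1
  push_cast
  ring

/-- The translation parameter enters the frequency integral only through the conjugate phase, so at
a fixed scale the transform is an inverse Fourier integral. This makes Plancherel in `u` available.
-/
theorem ccwt_eq_fourier (h : AnalyticWavelet φ Φ) (hz : MemLp z 2 volume) (u : ℝ) {s : ℝ}
    (hs : 0 < s) : ccwt φ z u s = 𝓕 (slice Φ hz s) (-u) := by
  rw [h.ccwt_eq_integral hz u hs, Real.fourier_real_eq_integral_exp_smul]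
  congr 1
  funext ξ
  rw [star_phase, phase, smul_eq_mul]
  congr 4
  ring

theorem memLp_fourier {g : ℝ → ℂ} (h1 : Integrable g) (h2 : MemLp g 2 volume) :
    MemLp (fun u => 𝓕 g (-u)) 2 volume :=
  ((Lp.memLp _).ae_eq (fourier_toLp_ae h1 h2)).comp_measurePreserving
    (Measure.measurePreserving_neg volume)

theorem integral_fourier_neg_mul_star {g k : ℝ → ℂ} (h1 : Integrable g) (h2 : MemLp g 2 volume)
    (h1' : Integrable k) (h2' : MemLp k 2 volume) :
    ∫ u, 𝓕 g (-u) * star (𝓕 k (-u)) = ∫ ξ, g ξ * star (k ξ) := by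
  rw [integral_neg_eq_self (fun u => 𝓕 g u * star (𝓕 k u)) volume, integral_mul_star_eq_ft h2 h2']
  apply integral_congr_ae
  filter_upwards [fourier_toLp_ae h1 h2, fourier_toLp_ae h1' h2'] with ξ e e'
  rw [ft, ft, e, e']

theorem memLp_ccwt (h : AnalyticWavelet φ Φ) (hz : MemLp z 2 volume) {s : ℝ} (hs : 0 < s)
    (hG : MemLp (slice Φ hz s) 2 volume) : MemLp (fun u => ccwt φ z u s) 2 volume := by
  simp_rw [h.ccwt_eq_fourier hz _ hs]
  exact memLp_fourier (h.integrable_slice hz hs) hG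

/-- Plancherel in `u`. Slices are integrable at every scale, but square integrability is only known
at almost every scale (`ae_memLp_slice`), so it is a hypothesis here. -/
theorem integral_ccwt_mul_star (h : AnalyticWavelet φ Φ) (hz : MemLp z 2 volume)
    (hw : MemLp w 2 volume) {s : ℝ} (hs : 0 < s)
    (hG : MemLp (slice Φ hz s) 2 volume) (hG' : MemLp (slice Φ hw s) 2 volume) :
    ∫ u, ccwt φ z u s * star (ccwt φ w u s) =
      ∫ ξ, slice Φ hz s ξ * star (slice Φ hw s ξ) := by
  simp_rw [h.ccwt_eq_fourier hz _ hs, h.ccwt_eq_fourier hw _ hs]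
  exact integral_fourier_neg_mul_star (h.integrable_slice hz hs) hG (h.integrable_slice hw hs) hG'

/-! ### Calderón's identity and the frequency density. -/

theorem integrableOn_dilate (h : AnalyticWavelet φ Φ) (ξ : ℝ) :
    IntegrableOn (fun s => ‖Φ (s * ξ)‖ ^ 2 / s) (Ioi 0) volume := by
  rcases le_or_gt ξ 0 with hξ | hξ
  · refine integrableOn_zero.congr_fun (fun s hs => ?_) measurableSet_Ioi
    simp [h.zero (s * ξ) (mul_nonpos_of_nonneg_of_nonpos (le_of_lt hs) hξ)]
  · have := (integrableOn_Ioi_comp_mul_right_iff (fun x => ‖Φ x‖ ^ 2 / x) 0 hξ).2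
      (by simpa using h.integrable)
    refine (this.const_mul ξ).congr (Eventually.of_forall fun s => ?_)
    simp only
    field_simp

/-- For `ξ > 0` the substitution `x = s ξ` leaves `ds / s` invariant; for `ξ ≤ 0` the argument `s ξ`
never reaches the support of `Φ`. -/
theorem integral_dilate (h : AnalyticWavelet φ Φ) (ξ : ℝ) :
    ∫ s in Ioi (0 : ℝ), ‖Φ (s * ξ)‖ ^ 2 / s = (Ioi (0 : ℝ)).indicator (fun _ => cadm Φ) ξ := by
  rcases le_or_gt ξ 0 with hξ | hξ
  · rw [indicator_of_notMem (by simpa using hξ)]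
    refine setIntegral_eq_zero_of_forall_eq_zero fun s hs => ?_
    simp [h.zero (s * ξ) (mul_nonpos_of_nonneg_of_nonpos (le_of_lt hs) hξ)]
  · rw [indicator_of_mem (by simpa using hξ)]
    have := integral_comp_mul_right_Ioi (fun x => ‖Φ x‖ ^ 2 / x) 0 hξ
    rw [zero_mul] at this
    have h2 : ∀ s : ℝ, ‖Φ (s * ξ)‖ ^ 2 / s = ξ * (‖Φ (s * ξ)‖ ^ 2 / (s * ξ)) := by
      intro s; field_simp
    simp_rw [h2]
    rw [integral_const_mul, this, smul_eq_mul, cadm]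
    field_simp

theorem stronglyMeasurable_dilate (h : AnalyticWavelet φ Φ) :
    StronglyMeasurable fun p : ℝ × ℝ => Φ (p.1 * p.2) :=
  h.measurable.comp_measurable (by fun_prop)

/-- Tonelli with the scale integrated first: Calderón's identity leaves the constant times `|ẑ|²` on
positive frequencies, which is integrable. -/
theorem integrable_density (h : AnalyticWavelet φ Φ) (hz : MemLp z 2 volume) :
    Integrable (fun p : ℝ × ℝ => ‖ft z hz p.2‖ ^ 2 * (‖Φ (p.1 * p.2)‖ ^ 2 / p.1)) halfPlane := by
  have hm : StronglyMeasurable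
      (fun p : ℝ × ℝ => ‖ft z hz p.2‖ ^ 2 * (‖Φ (p.1 * p.2)‖ ^ 2 / p.1)) := by
    have h1 := (Lp.stronglyMeasurable (ft z hz)).comp_measurable
      (measurable_snd : Measurable (Prod.snd : ℝ × ℝ → ℝ))
    exact (h1.norm.pow 2).mul ((h.stronglyMeasurable_dilate.norm.pow 2).div
      measurable_fst.stronglyMeasurable)
  rw [halfPlane, integrable_prod_iff' hm.aestronglyMeasurable]
  refine ⟨Eventually.of_forall fun ξ =>
    (h.integrableOn_dilate ξ).const_mul (‖ft z hz ξ‖ ^ 2), ?_⟩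
  have h2 : Integrable (fun ξ => ‖ft z hz ξ‖ ^ 2 * cadm Φ) :=
    ((Lp.memLp (ft z hz)).norm.integrable_sq).mul_const _
  refine (h2.indicator measurableSet_Ioi (s := Ioi 0)).congr (Eventually.of_forall fun ξ => ?_)
  have e : ∫ s in Ioi (0 : ℝ), ‖‖ft z hz ξ‖ ^ 2 * (‖Φ (s * ξ)‖ ^ 2 / s)‖ =
      ∫ s in Ioi (0 : ℝ), ‖ft z hz ξ‖ ^ 2 * (‖Φ (s * ξ)‖ ^ 2 / s) := by
    refine setIntegral_congr_fun measurableSet_Ioi fun s hs => ?_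
    refine Real.norm_of_nonneg ?_
    have : (0 : ℝ) < s := hs
    positivity
  simp only
  rw [e, integral_const_mul, h.integral_dilate ξ]
  by_cases hξ : ξ ∈ Ioi (0 : ℝ) <;> simp [hξ]

theorem integrable_cross_density (h : AnalyticWavelet φ Φ) (hz : MemLp z 2 volume)
    (hw : MemLp w 2 volume) :
    Integrable (fun p : ℝ × ℝ => ft z hz p.2 * star (ft w hw p.2) *
      ((‖Φ (p.1 * p.2)‖ ^ 2 / p.1 : ℝ) : ℂ)) halfPlane := by
  refine ((h.integrable_density hz).add (h.integrable_density hw)).mono' ?_ ?_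
  · have h1 := (Lp.stronglyMeasurable (ft z hz)).comp_measurable
      (measurable_snd : Measurable (Prod.snd : ℝ × ℝ → ℝ))
    have h2 := (Lp.stronglyMeasurable (ft w hw)).comp_measurable
      (measurable_snd : Measurable (Prod.snd : ℝ × ℝ → ℝ))
    have h3 := (h.stronglyMeasurable_dilate.norm.pow 2).div
      (measurable_fst : Measurable (Prod.fst : ℝ × ℝ → ℝ)).stronglyMeasurable
    exact ((h1.mul h2.star).mul
      (Complex.continuous_ofReal.comp_stronglyMeasurable h3)).aestronglyMeasurable
  · have hpos : ∀ᵐ p : ℝ × ℝ ∂halfPlane, 0 < p.1 :=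
      Measure.quasiMeasurePreserving_fst.ae (ae_restrict_mem measurableSet_Ioi)
    filter_upwards [hpos] with p hp
    rw [norm_mul, norm_mul, _root_.norm_star, Complex.norm_real, Pi.add_apply, ← add_mul,
      Real.norm_of_nonneg (by positivity)]
    refine mul_le_mul_of_nonneg_right ?_ (by positivity)
    nlinarith [sq_nonneg (‖ft z hz p.2‖ - ‖ft w hw p.2‖), sq_nonneg ‖ft z hz p.2‖,
      sq_nonneg ‖ft w hw p.2‖]

theorem norm_slice_sq (hz : MemLp z 2 volume) {s : ℝ} (hs : 0 < s) (ξ : ℝ) :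
    ‖slice Φ hz s ξ‖ ^ 2 = s ^ 2 * (‖ft z hz ξ‖ ^ 2 * (‖Φ (s * ξ)‖ ^ 2 / s)) := by
  rw [slice, norm_mul, norm_mul, _root_.norm_star, Complex.norm_real,
    Real.norm_of_nonneg (Real.sqrt_nonneg s), mul_pow, mul_pow, Real.sq_sqrt hs.le]
  field_simp

theorem slice_mul_star (hz : MemLp z 2 volume) (hw : MemLp w 2 volume) {s : ℝ} (hs : 0 < s)
    (ξ : ℝ) :
    slice Φ hz s ξ * star (slice Φ hw s ξ) = ((s ^ 2 : ℝ) : ℂ) *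
      (ft z hz ξ * star (ft w hw ξ) * ((‖Φ (s * ξ)‖ ^ 2 / s : ℝ) : ℂ)) := by
  have h1 : (√s : ℂ) * (√s : ℂ) = s := by
    rw [← Complex.ofReal_mul, Real.mul_self_sqrt hs.le]
  have h2 : star (Φ (s * ξ)) * Φ (s * ξ) = ((‖Φ (s * ξ)‖ ^ 2 : ℝ) : ℂ) := by
    rw [RCLike.star_def, ← Complex.normSq_eq_conj_mul_self, Complex.sq_norm]
  have hs' : (s : ℂ) ≠ 0 := by exact_mod_cast hs.ne'
  calc slice Φ hz s ξ * star (slice Φ hw s ξ)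
      = ((√s : ℂ) * (√s : ℂ)) * (ft z hz ξ * star (ft w hw ξ)) *
          (star (Φ (s * ξ)) * Φ (s * ξ)) := by
        simp only [slice, star_mul', RCLike.star_def, Complex.conj_ofReal, Complex.conj_conj]
        ring
    _ = _ := by
        rw [h1, h2]
        push_cast
        field_simp

/-- Fubini in the other order: almost every section of the integrable density is integrable in `ξ`,
and that section is the squared slice up to the factor `s²`. -/
theorem ae_memLp_slice (h : AnalyticWavelet φ Φ) (hz : MemLp z 2 volume) :
    ∀ᵐ s ∂(volume.restrict (Ioi (0 : ℝ))), MemLp (slice Φ hz s) 2 volume := by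
  have h1 := (h.integrable_density hz).prod_right_ae
  filter_upwards [h1, ae_restrict_mem measurableSet_Ioi] with s hs hs0
  rw [memLp_two_iff_integrable_sq_norm (h.integrable_slice hz hs0).1]
  refine (hs.const_mul (s ^ 2)).congr (Eventually.of_forall fun ξ => ?_)
  simp only
  rw [norm_slice_sq hz hs0]

/-! ### Parseval's formula on the half plane. -/

/-- The wavelet transform as a function on the half plane, normalized by `1 / s`. -/
def analysis (φ z : ℝ → ℂ) (p : ℝ × ℝ) : ℂ := ((p.1⁻¹ : ℝ) : ℂ) * ccwt φ z p.2 p.1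

theorem ae_halfPlane_pos : ∀ᵐ p : ℝ × ℝ ∂halfPlane, 0 < p.1 :=
  Measure.quasiMeasurePreserving_fst.ae (ae_restrict_mem measurableSet_Ioi)

/-- Joint measurability in scale and translation is read off the frequency formula, a parameter
integral with jointly measurable integrand. -/
theorem aestronglyMeasurable_analysis (h : AnalyticWavelet φ Φ) (hz : MemLp z 2 volume) :
    AEStronglyMeasurable (analysis φ z) halfPlane := by
  have hm : StronglyMeasurable fun q : (ℝ × ℝ) × ℝ =>
      star (phase q.1.2 q.2) * slice Φ hz q.1.1 q.2 := by
    have h1 : StronglyMeasurable fun q : (ℝ × ℝ) × ℝ => phase q.1.2 q.2 :=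
      (continuous_phase.comp (by fun_prop : Continuous fun q : (ℝ × ℝ) × ℝ =>
        (q.1.2, q.2))).stronglyMeasurable
    have h2 : StronglyMeasurable fun q : (ℝ × ℝ) × ℝ => ft z hz q.2 :=
      (Lp.stronglyMeasurable (ft z hz)).comp_measurable measurable_snd
    have h3 : StronglyMeasurable fun q : (ℝ × ℝ) × ℝ => Φ (q.1.1 * q.2) :=
      h.measurable.comp_measurable (by fun_prop)
    have h4 : StronglyMeasurable fun q : (ℝ × ℝ) × ℝ => (√q.1.1 : ℂ) :=
      (by fun_prop : Continuous fun q : (ℝ × ℝ) × ℝ => (√q.1.1 : ℂ)).stronglyMeasurable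
    exact h1.star.mul (h4.mul (h2.mul h3.star))
  have hi : StronglyMeasurable fun p : ℝ × ℝ => ((p.1⁻¹ : ℝ) : ℂ) :=
    (by fun_prop : Measurable fun p : ℝ × ℝ => ((p.1⁻¹ : ℝ) : ℂ)).stronglyMeasurable
  refine (hi.mul (hm.integral_prod_right' (ν := volume))).aestronglyMeasurable.congr ?_
  filter_upwards [ae_halfPlane_pos] with p hp
  simp only [Pi.mul_apply, analysis]
  rw [h.ccwt_eq_integral hz _ hp]

theorem analysis_mul_star (s u : ℝ) :
    analysis φ z (s, u) * star (analysis φ w (s, u)) =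
      (((s ^ 2)⁻¹ : ℝ) : ℂ) * (ccwt φ z u s * star (ccwt φ w u s)) := by
  simp only [analysis, star_mul', RCLike.star_def, Complex.conj_ofReal]
  push_cast
  ring

theorem norm_analysis_sq (s u : ℝ) :
    ‖analysis φ z (s, u)‖ ^ 2 = (s ^ 2)⁻¹ * ‖ccwt φ z u s‖ ^ 2 := by
  simp only [analysis, norm_mul, Complex.norm_real, mul_pow, norm_inv, inv_pow, Real.norm_eq_abs,
    sq_abs]

/-- The weight `s⁻²` from the two normalizing factors cancels the `s²` that `slice_mul_star`
extracts to leave the invariant form `|Φ(s ξ)|² / s`. -/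
theorem ae_integral_analysis_mul_star (h : AnalyticWavelet φ Φ) (hz : MemLp z 2 volume)
    (hw : MemLp w 2 volume) :
    ∀ᵐ s ∂(volume.restrict (Ioi (0 : ℝ))),
      ∫ u, analysis φ z (s, u) * star (analysis φ w (s, u)) =
      ∫ ξ, ft z hz ξ * star (ft w hw ξ) * ((‖Φ (s * ξ)‖ ^ 2 / s : ℝ) : ℂ) := by
  filter_upwards [h.ae_memLp_slice hz, h.ae_memLp_slice hw, ae_restrict_mem measurableSet_Ioi]
    with s h1 h2 (hs : 0 < s)
  simp_rw [analysis_mul_star]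
  rw [integral_const_mul, h.integral_ccwt_mul_star hz hw hs h1 h2]
  simp_rw [slice_mul_star hz hw hs]
  rw [integral_const_mul, ← mul_assoc, ← Complex.ofReal_mul, inv_mul_cancel₀ (by positivity),
    Complex.ofReal_one, one_mul]

/-- Tonelli: integrating the squared modulus over `u` gives, at almost every scale, the `ξ`-integral
of the density in `integrable_density`. -/
theorem memLp_analysis (h : AnalyticWavelet φ Φ) (hz : MemLp z 2 volume) :
    MemLp (analysis φ z) 2 halfPlane := by
  have hm := h.aestronglyMeasurable_analysis hz
  rw [memLp_two_iff_integrable_sq_norm hm]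
  have hm2 : AEStronglyMeasurable (fun p => ‖analysis φ z p‖ ^ 2) halfPlane := hm.norm.pow 2
  rw [halfPlane, integrable_prod_iff hm2]
  constructor
  · filter_upwards [h.ae_memLp_slice hz, ae_restrict_mem measurableSet_Ioi] with s h1 hs
    simp_rw [norm_analysis_sq]
    exact ((h.memLp_ccwt hz hs h1).norm.integrable_sq).const_mul _
  · refine (h.integrable_density hz).integral_prod_left.congr ?_
    filter_upwards [h.ae_integral_analysis_mul_star hz hz] with s hs
    have e1 : ∫ u, analysis φ z (s, u) * star (analysis φ z (s, u)) =
        ((∫ u, ‖‖analysis φ z (s, u)‖ ^ 2‖ : ℝ) : ℂ) := by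
      rw [← integral_complex_ofReal]
      congr 1
      funext u
      simp [RCLike.star_def, Complex.mul_conj, Complex.normSq_eq_norm_sq]
    have e2 : ∫ ξ, ft z hz ξ * star (ft z hz ξ) * ((‖Φ (s * ξ)‖ ^ 2 / s : ℝ) : ℂ) =
        ((∫ ξ, ‖ft z hz ξ‖ ^ 2 * (‖Φ (s * ξ)‖ ^ 2 / s) : ℝ) : ℂ) := by
      rw [← integral_complex_ofReal]
      congr 1
      funext ξ
      simp [RCLike.star_def, Complex.mul_conj, Complex.normSq_eq_norm_sq]
    rw [e1, e2] at hs
    exact_mod_cast hs.symm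

/-- Parseval's formula for the wavelet transform, on the frequency side. -/
theorem integral_analysis_mul_star (h : AnalyticWavelet φ Φ) (hz : MemLp z 2 volume)
    (hw : MemLp w 2 volume) :
    ∫ p, analysis φ z p * star (analysis φ w p) ∂halfPlane =
      ∫ ξ, ft z hz ξ * star (ft w hw ξ) * ((Ioi (0 : ℝ)).indicator (fun _ => cadm Φ) ξ : ℝ) := by
  have hI : Integrable (fun p => analysis φ z p * star (analysis φ w p)) halfPlane :=
    (h.memLp_analysis hz).integrable_mul (h.memLp_analysis hw).star
  -- After Plancherel in `u` the order is exchanged so that the scale is integrated first, which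
  -- produces the Calderón integral.
  rw [halfPlane, integral_prod _ hI, integral_congr_ae (h.ae_integral_analysis_mul_star hz hw),
    integral_integral_swap (h.integrable_cross_density hz hw)]
  congr 1
  funext ξ
  rw [integral_const_mul, integral_complex_ofReal, h.integral_dilate ξ]

/-- Parseval's formula for the wavelet transform. -/
theorem integral_analysis_mul_star_of_hardy (h : AnalyticWavelet φ Φ) (hz : MemLp z 2 volume)
    (hw : MemLp w 2 volume) (hH : ∀ᵐ ξ : ℝ, ξ < 0 → ft z hz ξ = 0) :
    ∫ p, analysis φ z p * star (analysis φ w p) ∂halfPlane =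
      (cadm Φ : ℂ) * ∫ t, z t * star (w t) := by
  rw [h.integral_analysis_mul_star hz hw, integral_mul_star_eq_ft hz hw, ← integral_const_mul]
  apply integral_congr_ae
  have h0 : ∀ᵐ ξ : ℝ, ξ ≠ 0 := by simp [ae_iff]
  filter_upwards [hH, h0] with ξ h1 h2
  -- At negative frequencies `ẑ` alone kills both sides, so `w` may be arbitrary. The adjoint
  -- identity below depends on this.
  rcases lt_or_gt_of_ne h2 with h3 | h3
  · simp [h1 h3]
  · rw [indicator_of_mem (by simpa using h3)]
    ring

end AnalyticWavelet

/-! ### Exhaustion by bands of scales, and the synthesis kernel. -/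

theorem tendsto_eLpNorm_indicator_sub {α ι F : Type*} [MeasurableSpace α] [NormedAddCommGroup F]
    {μ : Measure α} {l : Filter ι} [l.IsCountablyGenerated] {f : α → F} (hf : MemLp f 2 μ)
    {S : ι → Set α} (hS : ∀ i, MeasurableSet (S i)) (hl : ∀ᵐ x ∂μ, ∀ᶠ i in l, x ∈ S i) :
    Tendsto (fun i => eLpNorm ((S i).indicator f - f) 2 μ) l (𝓝 0) := by
  have key : Tendsto (fun i => ∫⁻ t, ‖((S i).indicator f - f) t‖ₑ ^ (2 : ℝ) ∂μ)
      l (𝓝 (∫⁻ _ : α, 0 ∂μ)) := by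
    refine tendsto_lintegral_filter_of_dominated_convergence' (fun t => ‖f t‖ₑ ^ (2 : ℝ)) ?_ ?_ ?_ ?_
    · refine Eventually.of_forall fun i => ?_
      exact ((hf.1.indicator (hS i)).sub hf.1).enorm.pow_const _
    · refine Eventually.of_forall fun i => Eventually.of_forall fun t => ?_
      by_cases ht : t ∈ S i <;> simp [ht]
    · have := hf.2
      rw [eLpNorm_lt_top_iff_lintegral_rpow_enorm_lt_top (by norm_num) (by norm_num)] at this
      simpa using this.ne
    · filter_upwards [hl] with t ht
      refine tendsto_const_nhds.congr' ?_
      filter_upwards [ht] with i hi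
      simp [hi]
  have h2 := (ENNReal.continuous_rpow_const (y := (1 / 2 : ℝ))).continuousAt.tendsto.comp key
  simp only [lintegral_zero] at h2
  rw [ENNReal.zero_rpow_of_pos (by norm_num)] at h2
  refine h2.congr fun i => ?_
  rw [eLpNorm_eq_lintegral_rpow_enorm_toReal (by norm_num) (by norm_num)]
  simp

/-- The measure `ds du` on a band of scales. -/
def band (ε A : ℝ) : Measure (ℝ × ℝ) := (volume.restrict (Icc ε A)).prod volume

theorem halfPlane_restrict {ε : ℝ} (hε : 0 < ε) (A : ℝ) :
    halfPlane.restrict (Icc ε A ×ˢ univ) = band ε A := by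
  rw [halfPlane, ← Measure.prod_restrict, Measure.restrict_univ,
    Measure.restrict_restrict measurableSet_Icc, band]
  congr 2
  exact inter_eq_left.2 fun x hx => lt_of_lt_of_le hε hx.1

theorem ccwt_congr_ae {φ z z' : ℝ → ℂ} (h : z =ᵐ[volume] z') (u s : ℝ) :
    ccwt φ z u s = ccwt φ z' u s := by
  apply integral_congr_ae
  filter_upwards [h] with t ht
  rw [ht]

/-- The synthesis kernel `s⁻¹ φ_{u,s}(t)`. -/
def kernel (φ : ℝ → ℂ) (t : ℝ) (p : ℝ × ℝ) : ℂ := ((p.1⁻¹ : ℝ) : ℂ) * catom φ p.2 p.1 t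

theorem norm_sq_kernel (φ : ℝ → ℂ) (t : ℝ) {s : ℝ} (hs : 0 < s) (u : ℝ) :
    ‖kernel φ t (s, u)‖ ^ 2 = (s ^ 3)⁻¹ * ‖φ ((t - u) / s)‖ ^ 2 := by
  simp only [kernel, catom, norm_mul, Complex.norm_real, mul_pow, norm_inv, inv_pow,
    Real.norm_eq_abs, sq_abs, Real.sq_sqrt hs.le]
  field_simp

theorem integral_sq_dilate_translate {F : Type*} [NormedAddCommGroup F] (g : ℝ → F) (t : ℝ)
    {s : ℝ} (hs : 0 < s) :
    ∫ u, ‖g ((t - u) / s)‖ ^ 2 = s * ∫ x, ‖g x‖ ^ 2 := by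
  have h1 := integral_sub_left_eq_self (fun u => ‖g (u / s)‖ ^ 2) volume t
  have h2 := Measure.integral_comp_div (fun u => ‖g u‖ ^ 2) s
  rw [abs_of_pos hs, smul_eq_mul] at h2
  exact h1.trans h2

theorem memLp_dilate_translate {F : Type*} [NormedAddCommGroup F] {g : ℝ → F}
    (hg : MemLp g 2 volume) (t : ℝ) {s : ℝ} (hs : 0 < s) :
    MemLp (fun u => g ((t - u) / s)) 2 volume := by
  have h1 : MemLp (fun u => g (s⁻¹ * u)) 2 volume := memLp_comp_mul hg (inv_pos.2 hs)
  have h2 := h1.comp_measurePreserving (Measure.measurePreserving_sub_left volume t)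
  simpa [Function.comp_def, div_eq_inv_mul] using h2

/-! ### The analysis operator and its adjoint. -/

namespace AnalyticWavelet

variable {φ Φ z w : ℝ → ℂ}

theorem integrable_mul_star_catom (h : AnalyticWavelet φ Φ) (hz : MemLp z 2 volume) (u : ℝ)
    {s : ℝ} (hs : 0 < s) : Integrable (fun t => z t * star (catom φ u s t)) :=
  hz.integrable_mul (memLp_catom h.memLp u hs).star

theorem ccwt_add (h : AnalyticWavelet φ Φ) (hz : MemLp z 2 volume) (hw : MemLp w 2 volume) (u : ℝ)
    {s : ℝ} (hs : 0 < s) : ccwt φ (z + w) u s = ccwt φ z u s + ccwt φ w u s := by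
  rw [ccwt, ccwt, ccwt, ← integral_add (h.integrable_mul_star_catom hz u hs)
    (h.integrable_mul_star_catom hw u hs)]
  simp only [Pi.add_apply, add_mul]

theorem ccwt_smul (c : ℂ) (u s : ℝ) : ccwt φ (c • z) u s = c * ccwt φ z u s := by
  rw [ccwt, ccwt, ← integral_const_mul]
  simp only [Pi.smul_apply, smul_eq_mul, mul_assoc]

theorem cadm_nonneg (Φ : ℝ → ℂ) : 0 ≤ cadm Φ := by
  refine setIntegral_nonneg measurableSet_Ioi fun x hx => ?_
  have : (0 : ℝ) < x := hx
  positivity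

/-- The analysis operator, as a linear map. -/
def analysisₗ (h : AnalyticWavelet φ Φ) :
    Lp ℂ 2 (volume : Measure ℝ) →ₗ[ℂ] Lp ℂ 2 halfPlane where
  toFun f := (h.memLp_analysis (Lp.memLp f)).toLp _
  map_add' f g := by
    rw [← MemLp.toLp_add, MemLp.toLp_eq_toLp_iff]
    filter_upwards [ae_halfPlane_pos] with p hp
    rw [Pi.add_apply, analysis, analysis, analysis, ccwt_congr_ae (Lp.coeFn_add f g),
      h.ccwt_add (Lp.memLp f) (Lp.memLp g) _ hp, mul_add]
  map_smul' c f := by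
    rw [RingHom.id_apply, ← MemLp.toLp_const_smul, MemLp.toLp_eq_toLp_iff]
    refine Eventually.of_forall fun p => ?_
    rw [Pi.smul_apply, analysis, analysis, ccwt_congr_ae (Lp.coeFn_smul c f), ccwt_smul,
      smul_eq_mul, mul_left_comm]

theorem inner_toLp {α : Type*} [MeasurableSpace α] {μ : Measure α} {g k : α → ℂ}
    (hg : MemLp g 2 μ) (hk : MemLp k 2 μ) :
    inner ℂ (hg.toLp g) (hk.toLp k) = ∫ x, k x * star (g x) ∂μ := by
  rw [L2.inner_def]
  apply integral_congr_ae
  filter_upwards [hg.coeFn_toLp, hk.coeFn_toLp] with x e e'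
  rw [e, e', RCLike.inner_apply]
  rfl

/-- On the frequency side the operator multiplies `|f̂|²` by the constant or by `0`. The bound
therefore holds on all of `L²`, not only on Hardy functions, so an adjoint can be taken there. -/
theorem norm_analysisₗ_le (h : AnalyticWavelet φ Φ) (f : Lp ℂ 2 (volume : Measure ℝ)) :
    ‖h.analysisₗ f‖ ≤ √(cadm Φ) * ‖f‖ := by
  have hf := Lp.memLp f
  refine le_of_sq_le_sq ?_ (by positivity)
  rw [mul_pow, Real.sq_sqrt (cadm_nonneg Φ), ← Lp.norm_fourier_eq f]
  have e1 : ((‖h.analysisₗ f‖ ^ 2 : ℝ) : ℂ) = ∫ ξ, ft f hf ξ * star (ft f hf ξ) *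
      ((Ioi (0 : ℝ)).indicator (fun _ => cadm Φ) ξ : ℝ) := by
    rw [← h.integral_analysis_mul_star hf hf, ← inner_toLp (h.memLp_analysis hf)
      (h.memLp_analysis hf)]
    change _ = inner ℂ (h.analysisₗ f) (h.analysisₗ f)
    rw [inner_self_eq_norm_sq_to_K]
    push_cast
    rfl
  have e2 : ((‖𝓕 f‖ ^ 2 : ℝ) : ℂ) = ∫ ξ, ft f hf ξ * star (ft f hf ξ) := by
    have h2 : ft f hf = 𝓕 f := by rw [ft, Lp.toLp_coeFn]
    rw [h2]
    have := inner_toLp (Lp.memLp (𝓕 f)) (Lp.memLp (𝓕 f))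
    rw [← this, Lp.toLp_coeFn, inner_self_eq_norm_sq_to_K]
    push_cast
    rfl
  have hi : Integrable fun ξ => ‖ft f hf ξ‖ ^ 2 := (Lp.memLp (ft f hf)).norm.integrable_sq
  have e1' : ‖h.analysisₗ f‖ ^ 2 = ∫ ξ, ‖ft f hf ξ‖ ^ 2 *
      (Ioi (0 : ℝ)).indicator (fun _ => cadm Φ) ξ := by
    have : ((‖h.analysisₗ f‖ ^ 2 : ℝ) : ℂ) = ((∫ ξ, ‖ft f hf ξ‖ ^ 2 *
      (Ioi (0 : ℝ)).indicator (fun _ => cadm Φ) ξ : ℝ) : ℂ) := by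
      rw [e1, ← integral_complex_ofReal]
      congr 1
      funext ξ
      push_cast
      rw [RCLike.star_def, Complex.mul_conj, Complex.normSq_eq_norm_sq]
      push_cast
      rfl
    exact_mod_cast this
  have e2' : ‖𝓕 f‖ ^ 2 = ∫ ξ, ‖ft f hf ξ‖ ^ 2 := by
    have : ((‖𝓕 f‖ ^ 2 : ℝ) : ℂ) = ((∫ ξ, ‖ft f hf ξ‖ ^ 2 : ℝ) : ℂ) := by
      rw [e2, ← integral_complex_ofReal]
      congr 1
      funext ξ
      rw [RCLike.star_def, Complex.mul_conj, Complex.normSq_eq_norm_sq]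
    exact_mod_cast this
  rw [e1', e2', ← integral_const_mul]
  refine integral_mono_of_nonneg (Eventually.of_forall fun ξ => ?_) (hi.const_mul _)
    (Eventually.of_forall fun ξ => ?_)
  · exact mul_nonneg (sq_nonneg _) (indicator_nonneg (fun _ _ => cadm_nonneg Φ) _)
  · simp only
    rw [mul_comm]
    refine mul_le_mul_of_nonneg_right ?_ (sq_nonneg _)
    exact indicator_le_self' (fun _ _ => cadm_nonneg Φ) ξ

/-- The analysis operator. -/
def analysisL (h : AnalyticWavelet φ Φ) :
    Lp ℂ 2 (volume : Measure ℝ) →L[ℂ] Lp ℂ 2 halfPlane :=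
  h.analysisₗ.mkContinuous (√(cadm Φ)) h.norm_analysisₗ_le

theorem analysisL_toLp (h : AnalyticWavelet φ Φ) (hz : MemLp z 2 volume) :
    h.analysisL (hz.toLp z) = (h.memLp_analysis hz).toLp _ := by
  change (h.memLp_analysis (Lp.memLp (hz.toLp z))).toLp _ = _
  rw [MemLp.toLp_eq_toLp_iff]
  refine Eventually.of_forall fun p => ?_
  rw [analysis, analysis, ccwt_congr_ae hz.coeFn_toLp]

/-- Pairing with an arbitrary `g` turns this into Parseval's formula, which needs the Hardy
condition on `z` only. -/
theorem adjoint_analysisL_of_hardy (h : AnalyticWavelet φ Φ) (hz : MemLp z 2 volume)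
    (hH : ∀ᵐ ξ : ℝ, ξ < 0 → ft z hz ξ = 0) :
    h.analysisL.adjoint (h.analysisL (hz.toLp z)) = (cadm Φ : ℂ) • hz.toLp z := by
  refine ext_inner_left ℂ fun g => ?_
  rw [ContinuousLinearMap.adjoint_inner_right, inner_smul_right]
  have hg := Lp.memLp g
  rw [← Lp.toLp_coeFn g hg, h.analysisL_toLp, h.analysisL_toLp, inner_toLp, inner_toLp]
  exact h.integral_analysis_mul_star_of_hardy hz hg hH

/-! ### Synthesis over a band of scales and the complex inversion formula. -/

theorem stronglyMeasurable_kernel (h : AnalyticWavelet φ Φ) :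
    StronglyMeasurable fun q : (ℝ × ℝ) × ℝ => kernel φ q.2 q.1 := by
  have h1 : StronglyMeasurable fun q : (ℝ × ℝ) × ℝ => φ ((q.2 - q.1.2) / q.1.1) :=
    h.stronglyMeasurable.comp_measurable (by fun_prop)
  have h2 : StronglyMeasurable fun q : (ℝ × ℝ) × ℝ => ((q.1.1⁻¹ : ℝ) : ℂ) :=
    (by fun_prop : Measurable fun q : (ℝ × ℝ) × ℝ => ((q.1.1⁻¹ : ℝ) : ℂ)).stronglyMeasurable
  have h3 : StronglyMeasurable fun q : (ℝ × ℝ) × ℝ => (((√q.1.1)⁻¹ : ℝ) : ℂ) :=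
    (by fun_prop : Measurable fun q : (ℝ × ℝ) × ℝ => (((√q.1.1)⁻¹ : ℝ) : ℂ)).stronglyMeasurable
  exact h2.mul (h3.mul h1)

theorem integral_sq_kernel {t s : ℝ} (hs : 0 < s) :
    ∫ u, ‖kernel φ t (s, u)‖ ^ 2 = (s ^ 2)⁻¹ * ∫ x, ‖φ x‖ ^ 2 := by
  simp_rw [norm_sq_kernel φ t hs]
  rw [integral_const_mul, integral_sq_dilate_translate φ t hs]
  field_simp

/-- Integrating over `u` gives `s⁻² ‖φ‖²`, which is integrable over the band because its scales stay
away from `0`. -/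
theorem memLp_kernel (h : AnalyticWavelet φ Φ) {ε : ℝ} (hε : 0 < ε) (A t : ℝ) :
    MemLp (kernel φ t) 2 (band ε A) := by
  have hm : StronglyMeasurable (kernel φ t) :=
    h.stronglyMeasurable_kernel.comp_measurable (measurable_id.prodMk measurable_const)
  have hm2 : StronglyMeasurable fun p => ‖kernel φ t p‖ ^ 2 := hm.norm.pow 2
  rw [memLp_two_iff_integrable_sq_norm hm.aestronglyMeasurable, band,
    integrable_prod_iff hm2.aestronglyMeasurable]
  constructor
  · filter_upwards [ae_restrict_mem measurableSet_Icc] with s hs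
    have hs0 : 0 < s := lt_of_lt_of_le hε hs.1
    simp_rw [norm_sq_kernel φ t hs0]
    exact ((memLp_dilate_translate h.memLp t hs0).norm.integrable_sq).const_mul _
  · have hc : ContinuousOn (fun s : ℝ => (s ^ 2)⁻¹ * ∫ x, ‖φ x‖ ^ 2) (Icc ε A) := by
      refine ContinuousOn.mul (ContinuousOn.inv₀ (by fun_prop) fun s hs => ?_) continuousOn_const
      have hs0 : 0 < s := lt_of_lt_of_le hε hs.1
      positivity
    refine (hc.integrableOn_compact isCompact_Icc).congr ?_
    filter_upwards [ae_restrict_mem measurableSet_Icc] with s hs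
    rw [← integral_sq_kernel (lt_of_lt_of_le hε hs.1) (φ := φ) (t := t)]
    simp

theorem integral_band_sq_kernel (h : AnalyticWavelet φ Φ) {ε : ℝ} (hε : 0 < ε) (A t : ℝ) :
    ∫ p, ‖kernel φ t p‖ ^ 2 ∂(band ε A) = ∫ s in Icc ε A, (s ^ 2)⁻¹ * ∫ x, ‖φ x‖ ^ 2 := by
  have hi := (h.memLp_kernel hε A t).norm.integrable_sq
  rw [band] at hi ⊢
  rw [integral_prod _ hi]
  refine setIntegral_congr_fun measurableSet_Icc fun s hs => ?_
  exact integral_sq_kernel (lt_of_lt_of_le hε hs.1)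

theorem memLp_analysis_band (h : AnalyticWavelet φ Φ) (hz : MemLp z 2 volume) {ε : ℝ}
    (hε : 0 < ε) (A : ℝ) : MemLp (analysis φ z) 2 (band ε A) := by
  rw [← halfPlane_restrict hε A]
  exact (h.memLp_analysis hz).restrict _

theorem integrable_analysis_mul_kernel (h : AnalyticWavelet φ Φ) (hz : MemLp z 2 volume) {ε : ℝ}
    (hε : 0 < ε) (A t : ℝ) : Integrable (fun p => analysis φ z p * kernel φ t p) (band ε A) :=
  (h.memLp_analysis_band hz hε A).integrable_mul (h.memLp_kernel hε A t)

/-- The synthesis integral over a band of scales. -/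
def csynth (φ z : ℝ → ℂ) (ε A t : ℝ) : ℂ := ∫ p, analysis φ z p * kernel φ t p ∂(band ε A)

/-- A bound for the synthesis integral that is uniform in time. -/
def synthBound (φ z : ℝ → ℂ) (ε A : ℝ) : ℝ :=
  (∫ p, ‖analysis φ z p‖ ^ 2 ∂(band ε A)) + ∫ s in Icc ε A, (s ^ 2)⁻¹ * ∫ x, ‖φ x‖ ^ 2

/-- From `a b ≤ a² + b²`. The bound does not depend on `t`, since the squared kernel has the same
integral over the band for every `t`. -/
theorem integral_norm_analysis_mul_kernel_le (h : AnalyticWavelet φ Φ) (hz : MemLp z 2 volume)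
    {ε : ℝ} (hε : 0 < ε) (A t : ℝ) :
    ∫ p, ‖analysis φ z p * kernel φ t p‖ ∂(band ε A) ≤ synthBound φ z ε A := by
  have h1 := (h.memLp_analysis_band hz hε A).norm.integrable_sq
  have h2 := (h.memLp_kernel hε A t).norm.integrable_sq
  rw [synthBound, ← h.integral_band_sq_kernel hε A t, ← integral_add h1 h2]
  refine integral_mono (h.integrable_analysis_mul_kernel hz hε A t).norm (h1.add h2) fun p => ?_
  simp only [norm_mul]
  nlinarith [sq_nonneg (‖analysis φ z p‖ - ‖kernel φ t p‖), sq_nonneg ‖analysis φ z p‖,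
    sq_nonneg ‖kernel φ t p‖]

instance (ε A : ℝ) : SFinite (band ε A) := by unfold band; infer_instance

theorem aestronglyMeasurable_synth_integrand (h : AnalyticWavelet φ Φ) (hz : MemLp z 2 volume)
    {ε : ℝ} (hε : 0 < ε) (A : ℝ) :
    AEStronglyMeasurable (fun q : (ℝ × ℝ) × ℝ => analysis φ z q.1 * kernel φ q.2 q.1)
      ((band ε A).prod volume) :=
  ((h.memLp_analysis_band hz hε A).1.comp_fst).mul h.stronglyMeasurable_kernel.aestronglyMeasurable

theorem aestronglyMeasurable_csynth (h : AnalyticWavelet φ Φ) (hz : MemLp z 2 volume)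
    {ε : ℝ} (hε : 0 < ε) (A : ℝ) : AEStronglyMeasurable (csynth φ z ε A) volume :=
  (h.aestronglyMeasurable_synth_integrand hz hε A).prod_swap.integral_prod_right'

theorem norm_csynth_le (h : AnalyticWavelet φ Φ) (hz : MemLp z 2 volume)
    {ε : ℝ} (hε : 0 < ε) (A t : ℝ) : ‖csynth φ z ε A t‖ ≤ synthBound φ z ε A :=
  (norm_integral_le_integral_norm _).trans (h.integral_norm_analysis_mul_kernel_le hz hε A t)

/-- Justifies Fubini when the synthesis integral is tested against `q`. -/
theorem integrable_test_mul_synth (h : AnalyticWavelet φ Φ) (hz : MemLp z 2 volume)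
    {ε : ℝ} (hε : 0 < ε) (A : ℝ) {q : ℝ → ℂ} (hq : Integrable q) :
    Integrable (fun x : (ℝ × ℝ) × ℝ => q x.2 * (analysis φ z x.1 * kernel φ x.2 x.1))
      ((band ε A).prod volume) := by
  have hm : AEStronglyMeasurable
      (fun x : (ℝ × ℝ) × ℝ => q x.2 * (analysis φ z x.1 * kernel φ x.2 x.1))
      ((band ε A).prod volume) :=
    hq.1.comp_snd.mul (h.aestronglyMeasurable_synth_integrand hz hε A)
  rw [integrable_prod_iff' hm]
  refine ⟨Eventually.of_forall fun t =>
    (h.integrable_analysis_mul_kernel hz hε A t).const_mul (q t), ?_⟩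
  refine (hq.norm.mul_const (synthBound φ z ε A)).mono' hm.norm.prod_swap.integral_prod_right' ?_
  refine Eventually.of_forall fun t => ?_
  rw [Real.norm_of_nonneg (by positivity)]
  simp_rw [norm_mul (q t)]
  rw [integral_const_mul]
  exact mul_le_mul_of_nonneg_left (h.integral_norm_analysis_mul_kernel_le hz hε A t)
    (norm_nonneg _)

/-- For real-valued `q`, conjugation falls on the atom alone, so a pairing with the analysis of `q`
unfolds into a double integral against the synthesis kernel. -/
theorem star_analysis (q : ℝ → ℂ) (hq : ∀ t, star (q t) = q t) (p : ℝ × ℝ) :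
    star (analysis φ q p) = ∫ t, q t * kernel φ t p := by
  have e : star (ccwt φ q p.2 p.1) = ∫ t, q t * catom φ p.2 p.1 t := by
    rw [ccwt, RCLike.star_def, ← integral_conj]
    congr 1
    funext t
    have := hq t
    rw [RCLike.star_def] at this
    rw [map_mul, this, Complex.conj_conj]
  rw [analysis, star_mul', e, RCLike.star_def, Complex.conj_ofReal, ← integral_const_mul]
  congr 1
  funext t
  rw [kernel]
  ring

/-- Against a real test function, the adjoint moves to the analysis of that function,
`star_analysis` writes it as an integral in `t`, and Fubini reassembles the synthesis integral.
Square integrability of the latter comes as a consequence. -/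
theorem adjoint_analysisL_indicator (h : AnalyticWavelet φ Φ) (hz : MemLp z 2 volume) {ε : ℝ}
    (hε : 0 < ε) (A : ℝ) :
    h.analysisL.adjoint (((h.memLp_analysis hz).indicator
      (measurableSet_Icc.prod MeasurableSet.univ : MeasurableSet (Icc ε A ×ˢ univ))).toLp _)
      =ᵐ[volume] csynth φ z ε A := by
  have hS : MeasurableSet (Icc ε A ×ˢ (univ : Set ℝ)) := measurableSet_Icc.prod MeasurableSet.univ
  -- Identification by test functions requires local integrability, supplied by the bound uniform in
  -- `t`.
  have hb : MemLp (csynth φ z ε A) ∞ volume :=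
    memLp_top_of_bound (h.aestronglyMeasurable_csynth hz hε A) _
      (Eventually.of_forall (h.norm_csynth_le hz hε A))
  refine ae_eq_of_integral_contDiff_smul_eq
    ((Lp.memLp _).locallyIntegrable (by norm_num)) (hb.locallyIntegrable (by norm_num)) ?_
  intro g g_smooth g_cpt
  set q : ℝ → ℂ := fun t => (g t : ℂ) with hqdef
  have hqc : Continuous q := Complex.continuous_ofReal.comp g_smooth.continuous
  have hqs : HasCompactSupport q := g_cpt.comp_left (g := fun x : ℝ => (x : ℂ)) (by simp)
  have hq1 : Integrable q := hqc.integrable_of_hasCompactSupport hqs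
  have hq2 : MemLp q 2 volume := hqc.memLp_of_hasCompactSupport hqs
  have hqstar : ∀ t, star (q t) = q t := fun t => by
    rw [RCLike.star_def, hqdef]; exact Complex.conj_ofReal _
  set B := h.analysisL.adjoint (((h.memLp_analysis hz).indicator hS).toLp _) with hB
  have e1 : ∫ t, g t • B t = inner ℂ (hq2.toLp q) B := by
    have := inner_toLp hq2 (Lp.memLp B)
    rw [Lp.toLp_coeFn] at this
    rw [this]
    congr 1
    funext t
    rw [hqstar, Complex.real_smul, mul_comm]
  rw [e1, hB, ContinuousLinearMap.adjoint_inner_right, h.analysisL_toLp hq2, inner_toLp]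
  have e2 : ∀ p, (Icc ε A ×ˢ (univ : Set ℝ)).indicator (analysis φ z) p * star (analysis φ q p) =
      (Icc ε A ×ˢ (univ : Set ℝ)).indicator
        (fun p => analysis φ z p * star (analysis φ q p)) p := by
    intro p
    by_cases hp : p ∈ Icc ε A ×ˢ (univ : Set ℝ) <;> simp [hp]
  simp_rw [e2]
  rw [integral_indicator hS, halfPlane_restrict hε]
  have e3 : ∀ p, analysis φ z p * star (analysis φ q p) =
      ∫ t, q t * (analysis φ z p * kernel φ t p) := by
    intro p
    rw [star_analysis q hqstar, ← integral_const_mul]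
    congr 1
    funext t
    ring
  simp_rw [e3]
  rw [integral_integral_swap (h.integrable_test_mul_synth hz hε A hq1)]
  congr 1
  funext t
  rw [integral_const_mul, Complex.real_smul, csynth]

theorem memLp_csynth (h : AnalyticWavelet φ Φ) (hz : MemLp z 2 volume) {ε : ℝ}
    (hε : 0 < ε) (A : ℝ) : MemLp (csynth φ z ε A) 2 volume :=
  (Lp.memLp _).ae_eq (h.adjoint_analysisL_indicator hz hε A)

theorem coeFn_smul_sub {α : Type*} [MeasurableSpace α] {μ : Measure α} {B Z : Lp ℂ 2 μ}
    {b z : α → ℂ} (hB : B =ᵐ[μ] b) (hZ : Z =ᵐ[μ] z) (c : ℂ) :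
    (c • B - Z : Lp ℂ 2 μ) =ᵐ[μ] fun x => c * b x - z x := by
  filter_upwards [hB, hZ, Lp.coeFn_sub (c • B) Z, Lp.coeFn_smul c B] with x h1 h2 h3 h4
  rw [h3, Pi.sub_apply, h4, Pi.smul_apply, h1, h2, smul_eq_mul]

/-- If `T a = c z`, then `c⁻¹ T b - z = c⁻¹ T (b - a)`. Applied with `T` the adjoint, `a` the full
analysis and `b` its cut-off. -/
theorem eLpNorm_inv_mul_sub_le {α β : Type*} [MeasurableSpace α] [MeasurableSpace β]
    {μ : Measure α} {ν : Measure β} (T : Lp ℂ 2 ν →L[ℂ] Lp ℂ 2 μ) {a b : β → ℂ} {y z : α → ℂ}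
    (ha : MemLp a 2 ν) (hb : MemLp b 2 ν) (hz : MemLp z 2 μ) {B : Lp ℂ 2 μ}
    (hB : T (hb.toLp b) = B) (hy : B =ᵐ[μ] y) {c : ℂ} (hc : c ≠ 0)
    (hT : T (ha.toLp a) = c • hz.toLp z) :
    eLpNorm (fun t => c⁻¹ * y t - z t) 2 μ ≤ ‖c⁻¹ • T‖ₑ * eLpNorm (b - a) 2 ν := by
  have e1 : c⁻¹ • B - hz.toLp z = (c⁻¹ • T) ((hb.sub ha).toLp _) := by
    rw [MemLp.toLp_sub hb ha, map_sub, _root_.smul_apply, _root_.smul_apply, hT, hB, smul_smul,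
      inv_mul_cancel₀ hc, one_smul]
  have e2 := coeFn_smul_sub hy hz.coeFn_toLp c⁻¹
  rw [e1] at e2
  rw [← eLpNorm_congr_ae e2, ← Lp.enorm_def, ← Lp.enorm_toLp (hf := hb.sub ha)]
  exact (c⁻¹ • T).le_opENorm _

theorem eLpNorm_csynth_sub_le (h : AnalyticWavelet φ Φ) (hC : 0 < cadm Φ) (hz : MemLp z 2 volume)
    (hH : ∀ᵐ ξ : ℝ, ξ < 0 → ft z hz ξ = 0) {ε : ℝ} (hε : 0 < ε) (A : ℝ) :
    eLpNorm (fun t => (cadm Φ : ℂ)⁻¹ * csynth φ z ε A t - z t) 2 volume ≤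
      ‖((cadm Φ : ℂ)⁻¹) • h.analysisL.adjoint‖ₑ *
        eLpNorm ((Icc ε A ×ˢ univ).indicator (analysis φ z) - analysis φ z) 2 halfPlane := by
  have hC' : (cadm Φ : ℂ) ≠ 0 := by exact_mod_cast hC.ne'
  have e0 := h.adjoint_analysisL_of_hardy hz hH
  rw [h.analysisL_toLp hz] at e0
  exact eLpNorm_inv_mul_sub_le h.analysisL.adjoint (h.memLp_analysis hz) _ hz rfl
    (h.adjoint_analysisL_indicator hz hε A) hC' e0

theorem tendsto_csynth (h : AnalyticWavelet φ Φ) (hC : 0 < cadm Φ) (hz : MemLp z 2 volume)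
    (hH : ∀ᵐ ξ : ℝ, ξ < 0 → ft z hz ξ = 0) :
    Tendsto (fun p : ℝ × ℝ =>
      eLpNorm (fun t => (cadm Φ : ℂ)⁻¹ * csynth φ z p.1 p.2 t - z t) 2 volume)
      (𝓝[>] 0 ×ˢ atTop) (𝓝 0) := by
  have key := tendsto_eLpNorm_indicator_sub (h.memLp_analysis hz)
    (S := fun p : ℝ × ℝ => Icc p.1 p.2 ×ˢ (univ : Set ℝ)) (l := 𝓝[>] (0 : ℝ) ×ˢ atTop)
    (fun p => measurableSet_Icc.prod MeasurableSet.univ) (by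
      filter_upwards [ae_halfPlane_pos] with p hp
      have h1 : ∀ᶠ ε in 𝓝[>] (0 : ℝ), ε ≤ p.1 :=
        mem_of_superset (Ioc_mem_nhdsGT hp) fun x hx => hx.2
      filter_upwards [h1.prod_mk (eventually_ge_atTop p.1)] with x hx
      exact ⟨⟨hx.1, hx.2⟩, mem_univ _⟩)
  have hub := ENNReal.Tendsto.const_mul (a := ‖((cadm Φ : ℂ)⁻¹) • h.analysisL.adjoint‖ₑ) key
    (Or.inr enorm_ne_top)
  rw [mul_zero] at hub
  refine tendsto_of_tendsto_of_tendsto_of_le_of_le' tendsto_const_nhds hub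
    (Eventually.of_forall fun _ => bot_le) ?_
  have h1 : ∀ᶠ ε in 𝓝[>] (0 : ℝ), 0 < ε := eventually_mem_nhdsWithin
  filter_upwards [h1.prod_inl (atTop : Filter ℝ)] with p hp
  exact h.eLpNorm_csynth_sub_le hC hz hH hp p.2

end AnalyticWavelet

/-! ### Splitting quaternions into `ℂ_j`-components. -/

theorem quasiMeasurePreserving_affine {c : ℝ} (hc : c ≠ 0) (d : ℝ) :
    Measure.QuasiMeasurePreserving (fun t : ℝ => c * t + d) volume volume := by
  have h1 : Measure.QuasiMeasurePreserving (fun t : ℝ => c * t) volume volume := by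
    refine ⟨by fun_prop, ?_⟩
    rw [Real.map_volume_mul_left hc]
    exact Measure.smul_absolutelyContinuous
  exact (measurePreserving_add_right volume d).quasiMeasurePreserving.comp h1

theorem ofPair_fstJ_sndJ (q : ℍ) : ofPair (fstJ q) (sndJ q) = q := rfl

theorem ofPair_re (z w : ℂ) : (ofPair z w).re = z.re := rfl

theorem ofPair_imI (z w : ℂ) : (ofPair z w).imI = w.re := rfl

theorem ofPair_imJ (z w : ℂ) : (ofPair z w).imJ = z.im := rfl

theorem ofPair_imK (z w : ℂ) : (ofPair z w).imK = w.im := rfl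

theorem involJ_ofPair (z w : ℂ) : involJ (ofPair z w) = ofPair (star z) w := by
  rw [involJ_eq]; rfl

theorem ofPair_smul (c : ℝ) (z w : ℂ) : c • ofPair z w = ofPair (c * z) (c * w) := by
  ext <;> simp [ofPair_re, ofPair_imI, ofPair_imJ, ofPair_imK]

/-- In `z + i w` the unit `i` stands on the left, so right multiplication by `ℂ_j` does not mix the
components. -/
theorem ofPair_mul_ofPair_zero (z w c : ℂ) :
    ofPair z w * ofPair c 0 = ofPair (z * c) (w * c) := by
  ext <;> simp [ofPair_re, ofPair_imI, ofPair_imJ, ofPair_imK]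

theorem star_ofPair_zero (c : ℂ) : star (ofPair c 0) = ofPair (star c) 0 := by
  ext <;> simp [ofPair_re, ofPair_imI, ofPair_imJ, ofPair_imK]

theorem norm_sq_ofPair (z w : ℂ) : ‖ofPair z w‖ ^ 2 = ‖z‖ ^ 2 + ‖w‖ ^ 2 := by
  rw [sq, ← Quaternion.normSq_eq_norm_mul_self, Quaternion.normSq_def', Complex.sq_norm,
    Complex.sq_norm, Complex.normSq_apply, Complex.normSq_apply]
  simp only [ofPair]; ring

/-- Both components are combinations of products `a * star b`, so Parseval's formula applies to each
term. -/
theorem ofPair_mul_involJ (z w : ℂ) :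
    ofPair z w * involJ (ofPair z w) =
      ofPair (z * star z - w * star w) (2 * (w * star z)) := by
  rw [involJ_ofPair]
  ext <;> simp [ofPair_re, ofPair_imI, ofPair_imJ, ofPair_imK] <;> ring

/-- `ofPair` as a continuous real linear map. -/
def ofPairL : ℂ × ℂ →L[ℝ] ℍ :=
  ⟨{ toFun := fun p => ofPair p.1 p.2
     map_add' := fun _ _ => rfl
     map_smul' := fun c p => by
       ext <;> simp [ofPair_re, ofPair_imI, ofPair_imJ, ofPair_imK] }, continuous_ofPair⟩

theorem integrable_ofPair {α : Type*} [MeasurableSpace α] {μ : Measure α} {g k : α → ℂ}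
    (hg : Integrable g μ) (hk : Integrable k μ) : Integrable (fun x => ofPair (g x) (k x)) μ :=
  ofPairL.integrable_comp (hg.prodMk hk)

theorem integral_ofPair {α : Type*} [MeasurableSpace α] {μ : Measure α} {g k : α → ℂ}
    (hg : Integrable g μ) (hk : Integrable k μ) :
    ∫ x, ofPair (g x) (k x) ∂μ = ofPair (∫ x, g x ∂μ) (∫ x, k x ∂μ) := by
  have := ofPairL.integral_comp_comm (hg.prodMk hk)
  rw [integral_pair hg hk] at this
  exact this

theorem memLp_ofPair {α : Type*} [MeasurableSpace α] {μ : Measure α} {g k : α → ℂ}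
    (hg : MemLp g 2 μ) (hk : MemLp k 2 μ) : MemLp (fun x => ofPair (g x) (k x)) 2 μ := by
  refine (hg.norm.add hk.norm).mono
    (continuous_ofPair.comp_aestronglyMeasurable (hg.1.prodMk hk.1)) ?_
  exact Eventually.of_forall fun x => (norm_ofPair_le _ _).trans (Real.le_norm_self _)

theorem eLpNorm_ofPair_le {α : Type*} [MeasurableSpace α] {μ : Measure α} {g k : α → ℂ}
    (hg : AEStronglyMeasurable g μ) (hk : AEStronglyMeasurable k μ) :
    eLpNorm (fun x => ofPair (g x) (k x)) 2 μ ≤ eLpNorm g 2 μ + eLpNorm k 2 μ := by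
  rw [← eLpNorm_norm g, ← eLpNorm_norm k]
  refine le_trans ?_ (eLpNorm_add_le hg.norm hk.norm (by norm_num))
  exact eLpNorm_mono fun x => (norm_ofPair_le _ _).trans (Real.le_norm_self _)

theorem ft_congr {h g : ℝ → ℂ} (hh : MemLp h 2 volume) (hg : MemLp g 2 volume)
    (e : h =ᵐ[volume] g) : ft h hh = ft g hg := by
  rw [ft, ft, (MemLp.toLp_eq_toLp_iff hh hg).2 e]

theorem ft_eq_zero_iff {h : ℝ → ℂ} (hh : MemLp h 2 volume) : ft h hh = 0 ↔ h =ᵐ[volume] 0 := by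
  rw [← norm_eq_zero, ft, Lp.norm_fourier_eq, norm_eq_zero, Lp.eq_zero_iff_ae_eq_zero]
  exact ⟨fun e => hh.coeFn_toLp.symm.trans e, fun e => hh.coeFn_toLp.trans e⟩

/-- Passes from the angular frequency `ω` of the quaternion transform to `ξ = ω / (2π)`. -/
theorem qft_two_pi_mul {f : ℝ → ℍ} (hf : MemLp f 2 volume) :
    ∀ᵐ ξ : ℝ, qft f (2 * Real.pi * ξ) =
      ofPair (ft _ (memLp_fstJ hf) ξ) (ft _ (memLp_sndJ hf) ξ) := by
  have hpi : (2 * Real.pi : ℝ) ≠ 0 := by positivity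
  have := (quasiMeasurePreserving_affine hpi 0).ae (qft_ae_eq hf)
  filter_upwards [this] with ξ h
  rw [add_zero] at h
  rw [h, qftPair, mul_div_cancel_left₀ _ hpi]
  rfl

theorem MemHardy.ft_eq_zero {f : ℝ → ℍ} (hf : MemHardy f) :
    (∀ᵐ ξ : ℝ, ξ < 0 → ft _ (memLp_fstJ hf.1) ξ = 0) ∧
    (∀ᵐ ξ : ℝ, ξ < 0 → ft _ (memLp_sndJ hf.1) ξ = 0) := by
  have hpi : (0 : ℝ) < 2 * Real.pi := by positivity
  have h0 := (quasiMeasurePreserving_affine hpi.ne' 0).ae hf.2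
  have key : ∀ᵐ ξ : ℝ, ξ < 0 →
      ofPair (ft _ (memLp_fstJ hf.1) ξ) (ft _ (memLp_sndJ hf.1) ξ) = 0 := by
    filter_upwards [h0, qft_two_pi_mul hf.1] with ξ h1 h2 hξ
    rw [← h2]
    rw [add_zero] at h1
    exact h1 (mul_neg_of_pos_of_neg hpi hξ)
  constructor
  · filter_upwards [key] with ξ h hξ
    exact congrArg fstJ (h hξ)
  · filter_upwards [key] with ξ h hξ
    exact congrArg sndJ (h hξ)

/-- A strongly measurable representative and a spectrum cut off at `0` make the required properties
hold pointwise. The constants agree without a factor `2π` because `dω / ω` is invariant under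
dilation. -/
theorem IsPolarizationWavelet.exists_analyticWavelet {ψ : ℝ → ℍ} (hψ : IsPolarizationWavelet ψ)
    (hadm : IsAdmissible ψ) : ∃ φ Φ : ℝ → ℂ, AnalyticWavelet φ Φ ∧ cadm Φ = admConst ψ ∧
      ψ =ᵐ[volume] fun t => ofPair (φ t) 0 := by
  have hL := hψ.memHardy.1
  have hφ₀ := memLp_fstJ hL
  set φ : ℝ → ℂ := hφ₀.1.mk with hφdef
  have hae : (fun t => fstJ (ψ t)) =ᵐ[volume] φ := hφ₀.1.ae_eq_mk
  have hφ : MemLp φ 2 volume := hφ₀.ae_eq hae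
  have hft : ft _ hφ₀ = ft φ hφ := ft_congr _ _ hae
  have hsnd : (fun t => sndJ (ψ t)) =ᵐ[volume] 0 := by
    filter_upwards [hψ.values] with t ht
    apply Complex.ext
    · exact ht.1
    · exact ht.2
  have hft2 : ft _ (memLp_sndJ hL) = 0 := (ft_eq_zero_iff _).2 hsnd
  set Φ : ℝ → ℂ := (Ioi (0 : ℝ)).indicator (ft φ hφ) with hΦ
  have hpi : (0 : ℝ) < 2 * Real.pi := by positivity
  have hq : ∀ᵐ ξ ∂(volume.restrict (Ioi (0 : ℝ))),
      2 * Real.pi * (‖qft ψ (ξ * (2 * Real.pi))‖ ^ 2 / (ξ * (2 * Real.pi))) = ‖Φ ξ‖ ^ 2 / ξ := by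
    have h0 := Lp.coeFn_zero ℂ 2 (volume : Measure ℝ)
    filter_upwards [ae_restrict_of_ae (qft_two_pi_mul hL), ae_restrict_of_ae h0,
      ae_restrict_mem measurableSet_Ioi] with ξ h1 h2 h3
    rw [mul_comm ξ, h1, hft, hft2, h2, hΦ, indicator_of_mem h3, norm_sq_ofPair]
    have : (0 : ℝ) < ξ := h3
    simp only [Pi.zero_apply, norm_zero]
    field_simp
    ring
  refine ⟨φ, Φ, ⟨hφ₀.1.stronglyMeasurable_mk, hφ, ?_, ?_, ?_, ?_⟩, ?_, ?_⟩
  · exact (Lp.stronglyMeasurable _).indicator measurableSet_Ioi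
  · have h0 : ∀ᵐ ξ : ℝ, ξ ≠ 0 := by simp [ae_iff]
    filter_upwards [h0, hψ.memHardy.ft_eq_zero.1] with ξ h1 h2
    rw [hft] at h2
    rcases lt_or_gt_of_ne h1 with h3 | h3
    · rw [h2 h3, hΦ, indicator_of_notMem]
      simpa using h3.le
    · rw [hΦ, indicator_of_mem (by simpa using h3)]
  · intro ξ hξ
    rw [hΦ, indicator_of_notMem]
    simpa using hξ
  · have := (integrableOn_Ioi_comp_mul_right_iff (fun ω => ‖qft ψ ω‖ ^ 2 / ω) 0 hpi).2
      (by rw [zero_mul]; exact hadm)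
    exact (this.const_mul (2 * Real.pi)).congr hq
  · rw [cadm, ← integral_congr_ae hq, integral_const_mul,
      integral_comp_mul_right_Ioi (fun ω => ‖qft ψ ω‖ ^ 2 / ω) 0 hpi, zero_mul, smul_eq_mul,
      ← mul_assoc, mul_inv_cancel₀ hpi.ne', one_mul, admConst]
  · filter_upwards [hae, hsnd] with t h1 h2
    rw [← ofPair_fstJ_sndJ (ψ t), h1, h2]
    rfl

/-- If the constant vanished, `Φ` would vanish almost everywhere on `(0, ∞)`, hence on `ℝ`, and
Plancherel would give `φ = 0`. -/
theorem cadm_pos {φ Φ : ℝ → ℂ} (h : AnalyticWavelet φ Φ) (hne : ¬ φ =ᵐ[volume] 0) :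
    0 < cadm Φ := by
  refine (AnalyticWavelet.cadm_nonneg Φ).lt_of_ne' fun h0 => hne ?_
  have hnn : 0 ≤ᵐ[volume.restrict (Ioi (0 : ℝ))] fun x => ‖Φ x‖ ^ 2 / x := by
    filter_upwards [ae_restrict_mem measurableSet_Ioi] with x hx
    have : (0 : ℝ) < x := hx
    simp only [Pi.zero_apply]
    positivity
  have h1 := (integral_eq_zero_iff_of_nonneg_ae hnn h.integrable).1 h0
  rw [Filter.EventuallyEq, ae_restrict_iff' measurableSet_Ioi] at h1
  rw [← ft_eq_zero_iff h.memLp, Lp.ext_iff]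
  filter_upwards [h1, h.ft_ae, Lp.coeFn_zero ℂ 2 (volume : Measure ℝ)] with x hx h2 h3
  rw [h2, h3]
  rcases le_or_gt x 0 with hx0 | hx0
  · exact h.zero x hx0
  · have := hx hx0
    simpa [hx0.ne'] using this

/-! ### Reduction of the quaternion transform to two complex ones. -/

section Reduction

variable {f ψ : ℝ → ℍ} {φ Φ : ℝ → ℂ}

theorem atom_eq {ψ : ℝ → ℍ} {φ : ℝ → ℂ} {u s t : ℝ}
    (h : ψ ((t - u) / s) = ofPair (φ ((t - u) / s)) 0) :
    atom ψ u s t = ofPair (catom φ u s t) 0 := by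
  rw [atom, h, ofPair_smul, mul_zero, catom]

theorem cwt_eq (h : AnalyticWavelet φ Φ) (hψ : ψ =ᵐ[volume] fun t => ofPair (φ t) 0)
    (hf : MemLp f 2 volume) (u : ℝ) {s : ℝ} (hs : 0 < s) :
    cwt ψ f u s = ofPair (ccwt φ (fun t => fstJ (f t)) u s) (ccwt φ (fun t => sndJ (f t)) u s) := by
  rw [cwt, ccwt, ccwt, ← integral_ofPair (h.integrable_mul_star_catom (memLp_fstJ hf) u hs)
    (h.integrable_mul_star_catom (memLp_sndJ hf) u hs)]
  apply integral_congr_ae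
  have hq := (quasiMeasurePreserving_affine (inv_ne_zero hs.ne') (-(s⁻¹ * u))).ae hψ
  filter_upwards [hq] with t ht
  have e : s⁻¹ * t + -(s⁻¹ * u) = (t - u) / s := by field_simp; ring
  rw [e] at ht
  rw [atom_eq ht, star_ofPair_zero, ← ofPair_mul_ofPair_zero, ofPair_fstJ_sndJ]

/-- With `t` fixed, each map `u ↦ (t - u) / s` pulls null sets back to null sets. The exceptional
set is thus null in `(s, u)` for every `t`, which gives the absolute convergence at every `t`. -/
theorem ae_atom_eq (hψ : ψ =ᵐ[volume] fun t => ofPair (φ t) 0) (t : ℝ) :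
    ∀ᵐ p ∂halfPlane, atom ψ p.2 p.1 t = ofPair (catom φ p.2 p.1 t) 0 := by
  -- A measurable hull of the exceptional set, so that its preimage in the half plane is measurable
  -- and can be tested section by section.
  set N := toMeasurable volume {x | ¬ ψ x = ofPair (φ x) 0} with hN
  have hN0 : volume N = 0 := by rw [hN, measure_toMeasurable]; exact hψ
  have hNm : MeasurableSet N := measurableSet_toMeasurable _ _
  have hM : MeasurableSet {p : ℝ × ℝ | (t - p.2) / p.1 ∈ N} :=
    (by fun_prop : Measurable fun p : ℝ × ℝ => (t - p.2) / p.1) hNm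
  have h0 : halfPlane {p : ℝ × ℝ | (t - p.2) / p.1 ∈ N} = 0 := by
    rw [halfPlane, Measure.measure_prod_null hM]
    filter_upwards [ae_restrict_mem measurableSet_Ioi] with s hs
    have hs' : (0 : ℝ) < s := hs
    have hq := (quasiMeasurePreserving_affine (neg_ne_zero.2 (inv_ne_zero hs'.ne'))
      (s⁻¹ * t)).preimage_null hN0
    refine measure_mono_null (fun u hu => ?_) hq
    have e : -s⁻¹ * u + s⁻¹ * t = (t - u) / s := by field_simp; ring
    rw [mem_preimage, e]
    exact hu
  filter_upwards [measure_eq_zero_iff_ae_notMem.1 h0] with p hp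
  refine atom_eq ?_
  by_contra hc
  exact hp (subset_toMeasurable _ _ hc)

theorem ae_synth_integrand_eq (h : AnalyticWavelet φ Φ) (hψ : ψ =ᵐ[volume] fun t => ofPair (φ t) 0)
    (hf : MemLp f 2 volume) (t : ℝ) :
    ∀ᵐ p ∂halfPlane, (p.1 ^ 2)⁻¹ • (cwt ψ f p.2 p.1 * atom ψ p.2 p.1 t) =
      ofPair (AnalyticWavelet.analysis φ (fun t => fstJ (f t)) p * kernel φ t p)
        (AnalyticWavelet.analysis φ (fun t => sndJ (f t)) p * kernel φ t p) := by
  filter_upwards [AnalyticWavelet.ae_halfPlane_pos, ae_atom_eq hψ t] with p hp ha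
  rw [cwt_eq h hψ hf _ hp, ha, ofPair_mul_ofPair_zero, ofPair_smul]
  simp only [AnalyticWavelet.analysis, kernel]
  push_cast
  congr 1 <;> ring

theorem volume_restrict_halfPlane :
    (volume : Measure (ℝ × ℝ)).restrict (Ioi 0 ×ˢ univ) = halfPlane := by
  rw [Measure.volume_eq_prod, ← Measure.prod_restrict, Measure.restrict_univ, halfPlane]

theorem volume_restrict_band (ε A : ℝ) :
    (volume : Measure (ℝ × ℝ)).restrict (Icc ε A ×ˢ univ) = band ε A := by
  rw [Measure.volume_eq_prod, ← Measure.prod_restrict, Measure.restrict_univ, band]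

theorem ae_band_of_ae_halfPlane {P : ℝ × ℝ → Prop} (hP : ∀ᵐ p ∂halfPlane, P p) {ε : ℝ}
    (hε : 0 < ε) (A : ℝ) : ∀ᵐ p ∂(band ε A), P p := by
  rw [← halfPlane_restrict hε A]
  exact ae_restrict_of_ae hP

theorem integrable_synth_integrand (h : AnalyticWavelet φ Φ)
    (hψ : ψ =ᵐ[volume] fun t => ofPair (φ t) 0) (hf : MemLp f 2 volume) (t : ℝ) {ε : ℝ}
    (hε : 0 < ε) (A : ℝ) :
    Integrable (fun p : ℝ × ℝ => (p.1 ^ 2)⁻¹ • (cwt ψ f p.2 p.1 * atom ψ p.2 p.1 t))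
      (band ε A) := by
  refine (integrable_ofPair (h.integrable_analysis_mul_kernel (memLp_fstJ hf) hε A t)
    (h.integrable_analysis_mul_kernel (memLp_sndJ hf) hε A t)).congr ?_
  filter_upwards [ae_band_of_ae_halfPlane (ae_synth_integrand_eq h hψ hf t) hε A] with p hp
  exact hp.symm

/-- Fubini identifies the iterated integral with the integral over the band, for every `t` and not
merely almost every one. -/
theorem synth_eq (h : AnalyticWavelet φ Φ) (hψ : ψ =ᵐ[volume] fun t => ofPair (φ t) 0)
    (hf : MemLp f 2 volume) {ε : ℝ} (hε : 0 < ε) (A t : ℝ) :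
    synth ψ f ε A t = ofPair (AnalyticWavelet.csynth φ (fun t => fstJ (f t)) ε A t)
      (AnalyticWavelet.csynth φ (fun t => sndJ (f t)) ε A t) := by
  have hi := integrable_synth_integrand h hψ hf t hε A
  simp only [AnalyticWavelet.csynth]
  rw [← integral_ofPair (h.integrable_analysis_mul_kernel (memLp_fstJ hf) hε A t)
    (h.integrable_analysis_mul_kernel (memLp_sndJ hf) hε A t),
    ← integral_congr_ae (ae_band_of_ae_halfPlane (ae_synth_integrand_eq h hψ hf t) hε A)]
  rw [band] at hi ⊢
  rw [integral_prod _ hi, synth]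
  simp_rw [integral_smul]

theorem memLp_synth (h : AnalyticWavelet φ Φ) (hψ : ψ =ᵐ[volume] fun t => ofPair (φ t) 0)
    (hf : MemLp f 2 volume) {ε : ℝ} (hε : 0 < ε) (A : ℝ) : MemLp (synth ψ f ε A) 2 volume := by
  rw [funext (synth_eq h hψ hf hε A)]
  exact memLp_ofPair (h.memLp_csynth (memLp_fstJ hf) hε A) (h.memLp_csynth (memLp_sndJ hf) hε A)

theorem tendsto_synth (h : AnalyticWavelet φ Φ) (hψ : ψ =ᵐ[volume] fun t => ofPair (φ t) 0)
    (hC : 0 < cadm Φ) (hf : MemHardy f) :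
    Tendsto (fun p : ℝ × ℝ =>
        eLpNorm (fun t => (cadm Φ)⁻¹ • synth ψ f p.1 p.2 t - f t) 2 volume)
      (𝓝[>] 0 ×ˢ atTop) (𝓝 0) := by
  have t1 := h.tendsto_csynth hC (memLp_fstJ hf.1) hf.ft_eq_zero.1
  have t2 := h.tendsto_csynth hC (memLp_sndJ hf.1) hf.ft_eq_zero.2
  have hub := t1.add t2
  rw [add_zero] at hub
  refine tendsto_of_tendsto_of_tendsto_of_le_of_le' tendsto_const_nhds hub
    (Eventually.of_forall fun _ => bot_le) ?_
  have h1 : ∀ᶠ ε in 𝓝[>] (0 : ℝ), 0 < ε := eventually_mem_nhdsWithin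
  filter_upwards [h1.prod_inl (atTop : Filter ℝ)] with p hp
  have e : ∀ t, (cadm Φ)⁻¹ • synth ψ f p.1 p.2 t - f t =
      ofPair ((cadm Φ : ℂ)⁻¹ * AnalyticWavelet.csynth φ (fun t => fstJ (f t)) p.1 p.2 t -
        fstJ (f t)) ((cadm Φ : ℂ)⁻¹ * AnalyticWavelet.csynth φ (fun t => sndJ (f t)) p.1 p.2 t -
        sndJ (f t)) := by
    intro t
    rw [synth_eq h hψ hf.1 hp, ofPair_smul, Complex.ofReal_inv, ← ofPair_sub, ofPair_fstJ_sndJ]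
  simp_rw [e]
  exact eLpNorm_ofPair_le
    (((h.memLp_csynth (memLp_fstJ hf.1) hp p.2).1.const_mul _).sub (memLp_fstJ hf.1).1)
    (((h.memLp_csynth (memLp_sndJ hf.1) hp p.2).1.const_mul _).sub (memLp_sndJ hf.1).1)

theorem energy_density_eq (h : AnalyticWavelet φ Φ) (hψ : ψ =ᵐ[volume] fun t => ofPair (φ t) 0)
    (hf : MemLp f 2 volume) :
    ∀ᵐ p ∂halfPlane, (p.1 ^ 2)⁻¹ * ‖cwt ψ f p.2 p.1‖ ^ 2 =
      ‖AnalyticWavelet.analysis φ (fun t => fstJ (f t)) p‖ ^ 2 +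
        ‖AnalyticWavelet.analysis φ (fun t => sndJ (f t)) p‖ ^ 2 := by
  filter_upwards [AnalyticWavelet.ae_halfPlane_pos] with p hp
  rw [cwt_eq h hψ hf _ hp, norm_sq_ofPair, ← Prod.mk.eta (p := p),
    AnalyticWavelet.norm_analysis_sq, AnalyticWavelet.norm_analysis_sq]
  ring

theorem integrable_energy_density (h : AnalyticWavelet φ Φ)
    (hψ : ψ =ᵐ[volume] fun t => ofPair (φ t) 0) (hf : MemLp f 2 volume) :
    Integrable (fun p : ℝ × ℝ => (p.1 ^ 2)⁻¹ * ‖cwt ψ f p.2 p.1‖ ^ 2) halfPlane := by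
  refine ((h.memLp_analysis (memLp_fstJ hf)).norm.integrable_sq.add
    (h.memLp_analysis (memLp_sndJ hf)).norm.integrable_sq).congr ?_
  filter_upwards [energy_density_eq h hψ hf] with p hp
  exact hp.symm

theorem integral_norm_sq_analysis (h : AnalyticWavelet φ Φ) {z : ℝ → ℂ} (hz : MemLp z 2 volume)
    (hH : ∀ᵐ ξ : ℝ, ξ < 0 → ft z hz ξ = 0) :
    ∫ p, ‖AnalyticWavelet.analysis φ z p‖ ^ 2 ∂halfPlane = cadm Φ * ∫ t, ‖z t‖ ^ 2 := by
  have key := h.integral_analysis_mul_star_of_hardy hz hz hH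
  have e : ∀ c : ℂ, c * star c = ((‖c‖ ^ 2 : ℝ) : ℂ) := fun c => by
    rw [RCLike.star_def, Complex.mul_conj, Complex.normSq_eq_norm_sq]
  simp_rw [e] at key
  rw [integral_complex_ofReal, integral_complex_ofReal] at key
  exact_mod_cast key

theorem energy_eq (h : AnalyticWavelet φ Φ) (hψ : ψ =ᵐ[volume] fun t => ofPair (φ t) 0)
    (hf : MemHardy f) :
    ∫ s in Ioi (0 : ℝ), (s ^ 2)⁻¹ * ∫ u : ℝ, ‖cwt ψ f u s‖ ^ 2 = cadm Φ * ∫ t, ‖f t‖ ^ 2 := by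
  have hi := integrable_energy_density h hψ hf.1
  have e1 : ∫ s in Ioi (0 : ℝ), (s ^ 2)⁻¹ * ∫ u : ℝ, ‖cwt ψ f u s‖ ^ 2 =
      ∫ p : ℝ × ℝ, (p.1 ^ 2)⁻¹ * ‖cwt ψ f p.2 p.1‖ ^ 2 ∂halfPlane := by
    rw [halfPlane] at hi ⊢
    rw [integral_prod _ hi]
    simp_rw [integral_const_mul]
  have e2 : ∫ t, ‖f t‖ ^ 2 = (∫ t, ‖fstJ (f t)‖ ^ 2) + ∫ t, ‖sndJ (f t)‖ ^ 2 := by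
    rw [← integral_add (memLp_fstJ hf.1).norm.integrable_sq (memLp_sndJ hf.1).norm.integrable_sq]
    congr 1
    funext t
    rw [← norm_sq_ofPair, ofPair_fstJ_sndJ]
  rw [e1, integral_congr_ae (energy_density_eq h hψ hf.1),
    integral_add (h.memLp_analysis (memLp_fstJ hf.1)).norm.integrable_sq
      (h.memLp_analysis (memLp_sndJ hf.1)).norm.integrable_sq,
    integral_norm_sq_analysis h _ hf.ft_eq_zero.1, integral_norm_sq_analysis h _ hf.ft_eq_zero.2,
    e2, mul_add]

theorem polarization_density_eq (h : AnalyticWavelet φ Φ)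
    (hψ : ψ =ᵐ[volume] fun t => ofPair (φ t) 0) (hf : MemLp f 2 volume) {z w : ℝ → ℂ}
    (hz : z = fun t => fstJ (f t)) (hw : w = fun t => sndJ (f t)) :
    ∀ᵐ p ∂halfPlane, (p.1 ^ 2)⁻¹ • (cwt ψ f p.2 p.1 * involJ (cwt ψ f p.2 p.1)) =
      ofPair (AnalyticWavelet.analysis φ z p * star (AnalyticWavelet.analysis φ z p) -
          AnalyticWavelet.analysis φ w p * star (AnalyticWavelet.analysis φ w p))
        (2 * (AnalyticWavelet.analysis φ w p * star (AnalyticWavelet.analysis φ z p))) := by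
  filter_upwards [AnalyticWavelet.ae_halfPlane_pos] with p hp
  rw [cwt_eq h hψ hf _ hp, ofPair_mul_involJ, ofPair_smul, ← Prod.mk.eta (p := p),
    AnalyticWavelet.analysis_mul_star, AnalyticWavelet.analysis_mul_star,
    AnalyticWavelet.analysis_mul_star, hz, hw]
  congr 1 <;> ring

theorem integrable_analysis_mul_star (h : AnalyticWavelet φ Φ) {z w : ℝ → ℂ}
    (hz : MemLp z 2 volume) (hw : MemLp w 2 volume) :
    Integrable (fun p => AnalyticWavelet.analysis φ z p * star (AnalyticWavelet.analysis φ w p))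
      halfPlane :=
  (h.memLp_analysis hz).integrable_mul (h.memLp_analysis hw).star

theorem integrable_polarization_density (h : AnalyticWavelet φ Φ)
    (hψ : ψ =ᵐ[volume] fun t => ofPair (φ t) 0) (hf : MemLp f 2 volume) :
    Integrable (fun p : ℝ × ℝ => (p.1 ^ 2)⁻¹ • (cwt ψ f p.2 p.1 * involJ (cwt ψ f p.2 p.1)))
      halfPlane := by
  have hz := memLp_fstJ hf
  have hw := memLp_sndJ hf
  refine (integrable_ofPair ((integrable_analysis_mul_star h hz hz).sub
    (integrable_analysis_mul_star h hw hw))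
    ((integrable_analysis_mul_star h hw hz).const_mul 2)).congr ?_
  filter_upwards [polarization_density_eq h hψ hf rfl rfl] with p hp
  exact hp.symm

/-- Parseval's formula is used for the pairs `(z, z)`, `(w, w)` and `(w, z)` of components of `f`;
each first entry is Hardy. -/
theorem polarization_eq (h : AnalyticWavelet φ Φ)
    (hψ : ψ =ᵐ[volume] fun t => ofPair (φ t) 0) (hf : MemHardy f) :
    ∫ s in Ioi (0 : ℝ), (s ^ 2)⁻¹ • ∫ u : ℝ, cwt ψ f u s * involJ (cwt ψ f u s) =
      cadm Φ • ∫ t, f t * involJ (f t) := by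
  have hi := integrable_polarization_density h hψ hf.1
  have e1 : ∫ s in Ioi (0 : ℝ), (s ^ 2)⁻¹ • ∫ u : ℝ, cwt ψ f u s * involJ (cwt ψ f u s) =
      ∫ p : ℝ × ℝ, (p.1 ^ 2)⁻¹ • (cwt ψ f p.2 p.1 * involJ (cwt ψ f p.2 p.1)) ∂halfPlane := by
    rw [halfPlane] at hi ⊢
    rw [integral_prod _ hi]
    simp_rw [integral_smul]
  have hz := memLp_fstJ hf.1
  have hw := memLp_sndJ hf.1
  have izz : Integrable fun t => fstJ (f t) * star (fstJ (f t)) := hz.integrable_mul hz.star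
  have iww : Integrable fun t => sndJ (f t) * star (sndJ (f t)) := hw.integrable_mul hw.star
  have iwz : Integrable fun t => sndJ (f t) * star (fstJ (f t)) := hw.integrable_mul hz.star
  have i1 : Integrable fun t =>
      fstJ (f t) * star (fstJ (f t)) - sndJ (f t) * star (sndJ (f t)) := izz.sub iww
  have e2 : ∫ t, f t * involJ (f t) =
      ofPair ((∫ t, fstJ (f t) * star (fstJ (f t))) - ∫ t, sndJ (f t) * star (sndJ (f t)))
        (2 * ∫ t, sndJ (f t) * star (fstJ (f t))) := by
    rw [← integral_sub izz iww, ← integral_const_mul,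
      ← integral_ofPair i1 (iwz.const_mul 2)]
    congr 1
    funext t
    rw [← ofPair_mul_involJ, ofPair_fstJ_sndJ]
  have i2 : Integrable (fun p => AnalyticWavelet.analysis φ (fun t => fstJ (f t)) p *
      star (AnalyticWavelet.analysis φ (fun t => fstJ (f t)) p) -
      AnalyticWavelet.analysis φ (fun t => sndJ (f t)) p *
      star (AnalyticWavelet.analysis φ (fun t => sndJ (f t)) p)) halfPlane :=
    (integrable_analysis_mul_star h hz hz).sub (integrable_analysis_mul_star h hw hw)
  rw [e1, integral_congr_ae (polarization_density_eq h hψ hf.1 rfl rfl), integral_ofPair i2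
      ((integrable_analysis_mul_star h hw hz).const_mul 2),
    integral_sub (integrable_analysis_mul_star h hz hz) (integrable_analysis_mul_star h hw hw),
    integral_const_mul, h.integral_analysis_mul_star_of_hardy hz hz hf.ft_eq_zero.1,
    h.integral_analysis_mul_star_of_hardy hw hw hf.ft_eq_zero.2,
    h.integral_analysis_mul_star_of_hardy hw hz hf.ft_eq_zero.2, e2, ofPair_smul]
  congr 1 <;> ring

end Reduction

theorem IsPolarizationWavelet.not_ae_eq_zero {ψ : ℝ → ℍ} (hψ : IsPolarizationWavelet ψ) :
    ¬ ψ =ᵐ[volume] 0 := by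
  intro h
  have h1 : ∫ t : ℝ, ‖ψ t‖ ^ 2 = 0 := by
    refine integral_eq_zero_of_ae ?_
    filter_upwards [h] with t ht
    simp [ht]
  exact one_ne_zero (hψ.norm_eq_one.symm.trans h1)

end QCWT

end

/-! ### The theorem. -/

theorem theorem3 (f ψ : ℝ → ℍ) (hf : QCWT.MemHardy f) (hψ : QCWT.IsPolarizationWavelet ψ)
    (hadm : QCWT.IsAdmissible ψ) :
    0 < QCWT.admConst ψ ∧
    -- inversion formula: the synthesis integral over any band of scales converges absolutely ...
    (∀ t ε A : ℝ, 0 < ε → ε ≤ A →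
      IntegrableOn (fun p : ℝ × ℝ =>
          (p.1 ^ 2)⁻¹ • (QCWT.cwt ψ f p.2 p.1 * QCWT.atom ψ p.2 p.1 t))
        (Icc ε A ×ˢ univ) volume) ∧
    (∀ ε A : ℝ, 0 < ε → ε ≤ A → MemLp (QCWT.synth ψ f ε A) 2 volume) ∧
    -- ... and, multiplied by `C_ψ⁻¹`, it tends to `f` in `L²` as the band exhausts `(0, ∞)`
    Tendsto (fun p : ℝ × ℝ =>
        eLpNorm (fun t => (QCWT.admConst ψ)⁻¹ • QCWT.synth ψ f p.1 p.2 t - f t) 2 volume)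
      (𝓝[>] 0 ×ˢ atTop) (𝓝 0) ∧
    -- conservation of energy
    IntegrableOn (fun p : ℝ × ℝ => (p.1 ^ 2)⁻¹ * ‖QCWT.cwt ψ f p.2 p.1‖ ^ 2)
      (Ioi 0 ×ˢ univ) volume ∧
    (QCWT.admConst ψ)⁻¹ *
        ∫ s in Ioi (0 : ℝ), (s ^ 2)⁻¹ * ∫ u : ℝ, ‖QCWT.cwt ψ f u s‖ ^ 2
      = ∫ t : ℝ, ‖f t‖ ^ 2 ∧
    -- conservation of the polarization properties
    IntegrableOn (fun p : ℝ × ℝ =>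
        (p.1 ^ 2)⁻¹ • (QCWT.cwt ψ f p.2 p.1 * QCWT.involJ (QCWT.cwt ψ f p.2 p.1)))
      (Ioi 0 ×ˢ univ) volume ∧
    ∫ t : ℝ, f t * QCWT.involJ (f t)
      = (QCWT.admConst ψ)⁻¹ •
        ∫ s in Ioi (0 : ℝ), (s ^ 2)⁻¹ •
          ∫ u : ℝ, QCWT.cwt ψ f u s * QCWT.involJ (QCWT.cwt ψ f u s) := by
  obtain ⟨φ, Φ, h, hC, hae⟩ := hψ.exists_analyticWavelet hadm
  have hf2 := hf.1
  -- The normalization `‖ψ‖ = 1` enters only here, to exclude `ψ = 0`.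
  have hpos : 0 < QCWT.admConst ψ := by
    rw [← hC]
    refine QCWT.cadm_pos h fun h0 => hψ.not_ae_eq_zero ?_
    filter_upwards [hae, h0] with t h1 h2
    rw [h1, h2]
    rfl
  have hpos' : 0 < QCWT.cadm Φ := hC ▸ hpos
  refine ⟨hpos, fun t ε A hε _ => ?_, fun ε A hε _ => QCWT.memLp_synth h hae hf2 hε A, ?_, ?_, ?_,
    ?_, ?_⟩
  · rw [IntegrableOn, QCWT.volume_restrict_band]
    exact QCWT.integrable_synth_integrand h hae hf2 t hε A
  · rw [← hC]
    exact QCWT.tendsto_synth h hae hpos' hf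
  · rw [IntegrableOn, QCWT.volume_restrict_halfPlane]
    exact QCWT.integrable_energy_density h hae hf2
  · rw [QCWT.energy_eq h hae hf, hC, ← mul_assoc, inv_mul_cancel₀ hpos.ne', one_mul]
  · rw [IntegrableOn, QCWT.volume_restrict_halfPlane]
    exact QCWT.integrable_polarization_density h hae hf2
  · rw [QCWT.polarization_eq h hae hf, hC, smul_smul, inv_mul_cancel₀ hpos.ne', one_smul]
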